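/- **Theorem 1.3.** Let $\beta\in\{2,4\}$ and, for $N\ge 1$, let $Q_N(z)=g_N(|z|)$ be a radial potential on $\mathbb C$, with $g_N$ real-valued. Let $dA=\frac1\pi d^2z$, and let $z_1,\dots,z_N\in\mathbb C$ be random points with joint law $$\frac{1}{Z_N^{(2)}}\prod_{j>k}|z_j-z_k|^2\prod_{j=1}^N e^{-NQ_N(z_j)}\,dA(z_j)\qquad(\beta=2),$$ $$\frac{1}{Z_N^{(4)}}\prod_{j>k}|z_j-z_k|^2|z_j-\bar z_k|^2\prod_{j=1}^N|z_j-\bar z_j|^2e^{-NQ_N(z_j)}\,dA(z_j)\qquad(\beta=4),$$ where $Z_N^{(\beta)}$ is the normalising constant. Let $V_N^{(\beta)}(a)$ be the variance of the number of points $z_j$ with $|z_j|<a$. Write $Q(z)=g(|z|)$ for the limit potential and $\Delta=\partial\bar\partial=\frac14(\partial_r^2+\frac1r\partial_r)$. Assume that the potentials are *suitable*, that is: 1. for every $N\ge1$, $g_N(r)/\log r\to\infty$ as $r\to\infty$, and $\int_0^1 r^{\beta-1}e^{-Ng_N(r)}\,dr<\infty$; 2. for every $N\ge1$, $g_N\in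 C^2(0,1]$, and $g_N\to g\in C^2(0,1]$ with $g_N,g_N',g_N''$ converging locally uniformly on $(0,1]$ (derivatives at $1$ being one-sided); 3. for every $N\ge1$, $g_N$ is differentiable on $(0,\infty)$ and $r g_N'(r)$ is nondecreasing on $(0,\infty)$; and $\Delta Q(z)>0$ for $0<|z|<1$; 4. $\lim_{r\to0}rg'(r)=0$ and $g'(1)=\beta$ (left derivative). Then the following holds. (i) **(Bulk)** For every fixed $a\in(0,1)$, $$\lim_{N\to\infty}\frac{\beta}{\sqrt{N\Delta Q(a)}}\,V_N^{(\beta)}(a)=\frac{2a}{\sqrt\pi}.$$ (ii) **(Edge)** Assume in addition that for some $R>1$ the functions $g_N$ and $g$ are $C^2$ on $(0,R)$ with $g_N,g_N',g_N''$ converging locally uniformly on $(0,R)$ to $g,g',g''$, that $\Delta Q(1)>0$, and that $\sqrt N\,(g_N'(1)-\beta)\to0$. Then for every $S\in\mathbb R$, $$\lim_{N\to\infty}\frac{\beta}{\sqrt{N\Delta Q(1)}}\,V_N^{(\beta)}\Big(1-\frac{S}{\sqrt{2\Delta Q(1)N}}\Big)=\frac{2}{\sqrt\pi}\,f(S),$$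 where, for every $S\in\mathbb R$, $$f(S):=\sqrt{2\pi}\int_{-\infty}^{S}\frac{\operatorname{erfc}(t)\operatorname{erfc}(-t)}{4}\,dt=\frac{\operatorname{erfc}(-\sqrt2S)}{2}-\frac{e^{-S^2}}{\sqrt2}\operatorname{erf}(S)+\sqrt{\frac\pi2}\,S\,\frac{\operatorname{erfc}(S)\operatorname{erfc}(-S)}{2}.$$ If $g_N=g$ does not depend on $N$, the integrability condition in 1 follows from the other conditions, all convergence conditions are void, and the additional assumption in (ii) says that $g$ is $C^2$ on $(0,R)$ for some $R>1$ with $\Delta Q(1)>0$. -/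

import Mathlib

open Set Filter Topology MeasureTheory

noncomputable section

namespace CoulombGas

/-! ### Error functions -/

/-- The error function, `erf x = (2/√π) ∫₀ˣ e^{-u²} du`. -/
def erf (x : ℝ) : ℝ := 2 / √Real.pi * ∫ u in (0 : ℝ)..x, Real.exp (-u ^ 2)

/-- The complementary error function. -/
def erfc (x : ℝ) : ℝ := 1 - erf x

/-- The edge scaling function `f(S) = √(2π) ∫_{-∞}^S erfc(t) erfc(-t) / 4 dt`. -/
def edgeFunction (S : ℝ) : ℝ :=
  √(2 * Real.pi) * ∫ t in Iic S, erfc t * erfc (-t) / 4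

/-! ### The planar complex (`β = 2`) and symplectic (`β = 4`) ensembles

The potential of the `N`-point ensemble is `Q(z) = g(|z|)`, given by its radial profile `g`. -/

/-- The normalised area measure `dA = d²z / π` on the complex plane. -/
def dA : Measure ℂ := (NNReal.pi)⁻¹ • (volume : Measure ℂ)

/-- The unnormalised joint density of the planar complex ensemble. -/
def complexDensity (N : ℕ) (g : ℝ → ℝ) (z : Fin N → ℂ) : ℝ :=
  (∏ j : Fin N, ∏ k ∈ Finset.Iio j, ‖z j - z k‖ ^ 2) *
    ∏ j : Fin N, Real.exp (-(N : ℝ) * g ‖z j‖)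

/-- The unnormalised joint density of the planar symplectic ensemble. -/
def symplecticDensity (N : ℕ) (g : ℝ → ℝ) (z : Fin N → ℂ) : ℝ :=
  (∏ j : Fin N, ∏ k ∈ Finset.Iio j,
      ‖z j - z k‖ ^ 2 * ‖z j - (starRingEnd ℂ) (z k)‖ ^ 2) *
    ∏ j : Fin N, ‖z j - (starRingEnd ℂ) (z j)‖ ^ 2 * Real.exp (-(N : ℝ) * g ‖z j‖)

/-- The unnormalised joint density with symmetry index `β`; only `β = 2` and `β = 4` are used. -/
def jointDensity (β N : ℕ) (g : ℝ → ℝ) : (Fin N → ℂ) → ℝ :=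
  if β = 2 then complexDensity N g else symplecticDensity N g

/-- The unnormalised law of the `N` points. -/
def weightMeasure (β N : ℕ) (g : ℝ → ℝ) : Measure (Fin N → ℂ) :=
  (Measure.pi fun _ : Fin N => dA).withDensity fun z => ENNReal.ofReal (jointDensity β N g z)

/-- The partition function. -/
def partitionFunction (β N : ℕ) (g : ℝ → ℝ) : ENNReal :=
  ∫⁻ z, ENNReal.ofReal (jointDensity β N g z) ∂(Measure.pi fun _ : Fin N => dA)

/-- The joint law of the `N` points. -/
def law (β N : ℕ) (g : ℝ → ℝ) : Measure (Fin N → ℂ) :=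
  (partitionFunction β N g)⁻¹ • weightMeasure β N g

/-- The number of points in the open disc of radius `a` about the origin. -/
def diskCount (N : ℕ) (a : ℝ) (z : Fin N → ℂ) : ℝ :=
  ((Finset.univ.filter fun j : Fin N => ‖z j‖ < a).card : ℝ)

/-- The number variance. -/
def numberVariance (β N : ℕ) (g : ℝ → ℝ) (a : ℝ) : ℝ :=
  ProbabilityTheory.variance (diskCount N a) (law β N g)

/-! ### Suitable potentials -/

/-- `ΔQ` at `|z| = r` for `Q(z) = g(|z|)`, where `Δ = ∂∂̄ = (∂_r² + r⁻¹ ∂_r) / 4`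
is a quarter of the usual Laplacian. -/
def radialLaplacian (g : ℝ → ℝ) (r : ℝ) : ℝ :=
  (deriv (deriv g) r + deriv g r / r) / 4

/-- Convergence in `C²_loc` on the set `s`: the functions and their first two derivatives
(one-sided at endpoints belonging to `s`) converge locally uniformly. -/
def C2Converges (gN : ℕ → ℝ → ℝ) (g : ℝ → ℝ) (s : Set ℝ) : Prop :=
  ∀ k : ℕ, k ≤ 2 → TendstoLocallyUniformlyOn
    (fun N => iteratedDerivWithin k (gN N) s) (iteratedDerivWithin k g s) atTop s

/-- Suitability of the radial potentials `Q_N(z) = gN N |z|` with limit `Q(z) = g |z|`. -/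
structure IsSuitable (β : ℕ) (gN : ℕ → ℝ → ℝ) (g : ℝ → ℝ) : Prop where
  /-- `g_N(r) ≫ log r` as `r → ∞`. -/
  growth : ∀ N : ℕ, 1 ≤ N → Tendsto (fun r => gN N r / Real.log r) atTop atTop
  /-- `g_N ∈ C²(0,1]`. -/
  contDiffOn : ∀ N : ℕ, 1 ≤ N → ContDiffOn ℝ 2 (gN N) (Ioc 0 1)
  /-- `g_N` is differentiable on `(0,∞)`. -/
  differentiableOn : ∀ N : ℕ, 1 ≤ N → DifferentiableOn ℝ (gN N) (Ioi 0)
  /-- `r g_N'(r)` increases on `(0,∞)`. -/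
  monotoneOn : ∀ N : ℕ, 1 ≤ N → MonotoneOn (fun r => r * deriv (gN N) r) (Ioi 0)
  /-- The weight is integrable at the origin, as is necessary for the partition function to be
  finite. When `gN` does not depend on `N`, this follows from `tendsto_zero`. -/
  integrable_zero : ∀ N : ℕ, 1 ≤ N →
    IntegrableOn (fun r => r ^ (β - 1) * Real.exp (-(N : ℝ) * gN N r)) (Ioc 0 1)
  /-- `g = lim g_N`. -/
  converges : C2Converges gN g (Ioc 0 1)
  /-- `g ∈ C²(0,1]`. -/
  contDiffOn_lim : ContDiffOn ℝ 2 g (Ioc 0 1)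
  /-- `ΔQ > 0`, the strict form of the monotonicity of `r g'(r)`. -/
  laplacian_pos : ∀ r ∈ Ioo (0 : ℝ) 1, 0 < radialLaplacian g r
  /-- `r g'(r) → 0` as `r → 0`. -/
  tendsto_zero : Tendsto (fun r => r * deriv g r) (𝓝[>] 0) (𝓝 0)
  /-- `g'(1) = β`. -/
  deriv_one : HasDerivWithinAt g β (Ioc 0 1) 1

/-- Regularity across the unit circle. When `gN` does not depend on `N`, it says that `g` is
`C²` on some `(0,R)` with `R > 1`, that `ΔQ(1) > 0` and that the two-sided `g'(1)` is `β`. -/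
structure IsEdgeRegular (β : ℕ) (gN : ℕ → ℝ → ℝ) (g : ℝ → ℝ) : Prop where
  /-- `g_N` and `g` are `C²` on a neighbourhood of `(0,1]`, with convergence in `C²_loc`. -/
  nhds : ∃ R : ℝ, 1 < R ∧ (∀ N : ℕ, 1 ≤ N → ContDiffOn ℝ 2 (gN N) (Ioo 0 R)) ∧
    ContDiffOn ℝ 2 g (Ioo 0 R) ∧ C2Converges gN g (Ioo 0 R)
  /-- `ΔQ > 0` on the unit circle. -/
  laplacian_pos : 0 < radialLaplacian g 1
  /-- `g_N'(1) = β + o(N^{-1/2})`: the edge at finite `N` is the unit circle up to `o(N^{-1/2})`. -/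
  deriv_one : Tendsto (fun N : ℕ => √(N : ℝ) * (deriv (gN N) 1 - β)) atTop (𝓝 0)

end CoulombGas

end

/-!
Write `w(z) = e^{-N g(|z|)}`. For both values of `β` the joint density is a polynomial in the `z_j`
and their conjugates times `∏ w(z_j)`; the polynomial is `|det (z_j^k)|²` for `β = 2`, and up to a
sign `∏ (z_j - conj z_j)` times the Vandermonde determinant of `z_1, …, z_N, conj z_1, …, conj z_N`
for `β = 4`. Against a radial observable only the monomials `∏ |z_j|^{2 m_j}` survive, and there
`(m_1, …, m_N)` is always a permutation of the exponents `2 m = β (k + 1) - 2`, `0 ≤ k < N`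
(`HasRadialExpansion`). Hence a symmetric radial observable sees independent moduli with densities
proportional to `r^{βk - 1} e^{-N g(r)}`, `1 ≤ k ≤ N`, and the number variance is
`∑_k p_k (1 - p_k)` with `p_k` the probability that the `k`-th modulus is less than `a`
(`numberVariance_eq_sum`).

In the coordinate `r = e^{b + v / √N}` with `a = e^b`, the `k`-th density becomes
`e^{s_k v - R_N(v)}`, where the slopes `s_k` form a grid of mesh `β / √N` and
`R_N(v) = N (h(b + v / √N) - h(b) - h'(b) v / √N)` with `h(u) = g(e^u)`
(`numberVariance_exp_eq_sum`). Monotonicity of `r g'(r)` says that `h` is convex, so `R_N` is a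
nonnegative convex function vanishing at `0`. By `C²` convergence it tends to `c v² / 2` with
`c = 4 a² ΔQ(a)` (`tendsto_localWell`). Convexity supplies all the uniform bounds:
`p_k (1 - p_k)` is at most a constant times `e^{-|s_k|}` (`IsConvexWell.tiltedVariance_le`), and the
integrals defining `p_k` are dominated (`eventually_exp_le`). So
`(β / √N) ∑_k p_k (1 - p_k)` is a Riemann sum converging to
`∫ erfc(s / √(2c)) erfc(-s / √(2c)) / 4 ds` over the limiting range of the slopes
(`tendsto_sum_tiltedVariance`). In the bulk this range is the whole line, because
`0 < a g'(a) < β`; at the edge it is `(-∞, √(2c) S]`. The integral is evaluated by an explicit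
antiderivative (`hasDerivAt_edgeClosedForm`).
-/

namespace CoulombGas

open scoped ComplexConjugate

/-! ### The complementary error function and the edge function -/

lemma integrable_exp_neg_sq : Integrable fun u : ℝ => Real.exp (-u ^ 2) := by
  simpa using integrable_exp_neg_mul_sq (b := 1) one_pos

lemma hasDerivAt_erf (x : ℝ) : HasDerivAt erf (2 / √Real.pi * Real.exp (-x ^ 2)) x := by
  have hc : Continuous fun u : ℝ => Real.exp (-u ^ 2) := by fun_prop
  exact (intervalIntegral.integral_hasDerivAt_right (hc.intervalIntegrable _ _)
    (hc.stronglyMeasurableAtFilter _ _) hc.continuousAt).const_mul _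

lemma hasDerivAt_erfc (x : ℝ) : HasDerivAt erfc (-(2 / √Real.pi * Real.exp (-x ^ 2))) x := by
  exact (hasDerivAt_erf x).const_sub 1

lemma continuous_erfc : Continuous erfc :=
  continuous_iff_continuousAt.2 fun x => (hasDerivAt_erfc x).continuousAt

lemma erf_neg (x : ℝ) : erf (-x) = -erf x := by
  have h := intervalIntegral.integral_comp_neg (a := 0) (b := x) fun u : ℝ => Real.exp (-u ^ 2)
  simp only [neg_sq, neg_zero] at h
  rw [erf, erf, h, intervalIntegral.integral_symm, mul_neg]

lemma erfc_eq_integral_Ioi (x : ℝ) :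
    erfc x = 2 / √Real.pi * ∫ u in Ioi x, Real.exp (-u ^ 2) := by
  have h0 : ∫ u in Ioi (0 : ℝ), Real.exp (-u ^ 2) = √Real.pi / 2 := by
    simpa using integral_gaussian_Ioi 1
  have h := intervalIntegral.integral_Ioi_sub_Ioi' (a := 0) (b := x)
    (integrable_exp_neg_sq.integrableOn (s := Ioi 0)) integrable_exp_neg_sq.integrableOn
  rw [h0] at h
  have hpi : √Real.pi ≠ 0 := by positivity
  rw [erfc, erf, ← h]
  field_simp
  ring

lemma erfc_eq_integral_Iio (x : ℝ) :
    erfc x = 2 / √Real.pi * ∫ u in Iio (-x), Real.exp (-u ^ 2) := by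
  have h := integral_comp_neg_Iic (-x) fun u : ℝ => Real.exp (-u ^ 2)
  simp only [neg_sq, neg_neg] at h
  rw [erfc_eq_integral_Ioi, ← h, integral_Iic_eq_integral_Iio]

lemma erfc_nonneg (x : ℝ) : 0 ≤ erfc x := by
  rw [erfc_eq_integral_Ioi]
  exact mul_nonneg (by positivity) (integral_nonneg fun u => (Real.exp_pos _).le)

lemma erfc_add_erfc_neg (x : ℝ) : erfc x + erfc (-x) = 2 := by
  rw [erfc, erfc, erf_neg]; ring

lemma erfc_le_two (x : ℝ) : erfc x ≤ 2 := by
  linarith [erfc_add_erfc_neg x, erfc_nonneg (-x)]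

lemma erfc_le_exp (x : ℝ) : erfc x ≤ 2 / √Real.pi * (Real.exp 1 * Real.exp (-x)) := by
  rw [erfc_eq_integral_Ioi, ← integral_exp_neg_Ioi x, ← integral_const_mul (Real.exp 1)]
  have hpi : 0 ≤ 2 / √Real.pi := by positivity
  refine mul_le_mul_of_nonneg_left (integral_mono integrable_exp_neg_sq.integrableOn
    ((integrableOn_exp_neg_Ioi x).const_mul _) fun u => ?_) hpi
  · simp only
    rw [← Real.exp_add]
    gcongr
    nlinarith [sq_nonneg (u - 1 / 2)]

lemma tendsto_mul_erfc_atTop : Tendsto (fun x => x * erfc x) atTop (𝓝 0) := by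
  have h : Tendsto (fun x : ℝ => 2 / √Real.pi * Real.exp 1 * (x ^ 1 * Real.exp (-x))) atTop
      (𝓝 (2 / √Real.pi * Real.exp 1 * 0)) :=
    (Real.tendsto_pow_mul_exp_neg_atTop_nhds_zero 1).const_mul _
  rw [mul_zero] at h
  refine tendsto_of_tendsto_of_tendsto_of_le_of_le' tendsto_const_nhds h ?_ ?_
  · filter_upwards [eventually_ge_atTop 0] with x hx using mul_nonneg hx (erfc_nonneg x)
  · filter_upwards [eventually_ge_atTop 0] with x hx
    calc x * erfc x ≤ x * (2 / √Real.pi * (Real.exp 1 * Real.exp (-x))) := by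
          gcongr; exact erfc_le_exp x
      _ = _ := by ring

lemma tendsto_erfc_atTop : Tendsto erfc atTop (𝓝 0) := by
  refine tendsto_of_tendsto_of_tendsto_of_le_of_le' tendsto_const_nhds tendsto_mul_erfc_atTop ?_ ?_
  · exact Eventually.of_forall erfc_nonneg
  · filter_upwards [eventually_ge_atTop 1] with x hx
    exact le_mul_of_one_le_left (erfc_nonneg x) hx

lemma tendsto_erfc_atBot : Tendsto erfc atBot (𝓝 2) := by
  have h := (tendsto_erfc_atTop.comp tendsto_neg_atBot_atTop).const_sub 2
  rw [sub_zero] at h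
  refine h.congr fun x => ?_
  simp only [Function.comp]
  linarith [erfc_add_erfc_neg x]

lemma integrable_exp_neg_abs : Integrable fun t : ℝ => Real.exp (-|t|) := by
  rw [← integrableOn_univ, ← Iic_union_Ioi (a := (0 : ℝ))]
  refine IntegrableOn.union ?_ ?_
  · refine (integrableOn_exp_Iic 0).congr_fun (fun t ht => ?_) measurableSet_Iic
    simp only [abs_of_nonpos (mem_Iic.1 ht), neg_neg]
  · refine (integrableOn_exp_neg_Ioi 0).congr_fun (fun t ht => ?_) measurableSet_Ioi
    simp only [abs_of_pos (mem_Ioi.1 ht)]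

lemma integrable_erfc_mul_erfc_neg : Integrable fun t => erfc t * erfc (-t) / 4 := by
  refine (integrable_exp_neg_abs.const_mul (1 / √Real.pi * Real.exp 1)).mono'
    (by have := continuous_erfc; fun_prop) (Eventually.of_forall fun t => ?_)
  rw [Real.norm_of_nonneg (by have := erfc_nonneg t; have := erfc_nonneg (-t); positivity)]
  rcases le_total 0 t with h | h
  · rw [abs_of_nonneg h]
    have := mul_le_mul (erfc_le_exp t) (erfc_le_two (-t)) (erfc_nonneg _) (by positivity)
    calc _ ≤ _ := div_le_div_of_nonneg_right this (by norm_num)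
      _ = _ := by ring
  · rw [abs_of_nonpos h]
    have := mul_le_mul (erfc_le_exp (-t)) (erfc_le_two t) (erfc_nonneg _) (by positivity)
    calc _ ≤ _ := div_le_div_of_nonneg_right ((mul_comm _ _).trans_le this) (by norm_num)
      _ = _ := by rw [neg_neg]; ring

/-- The closed form of `edgeFunction`, an antiderivative of its integrand that vanishes at `-∞`
and tends to `1` at `∞`. -/
noncomputable def edgeClosedForm (S : ℝ) : ℝ :=
  erfc (-(√2 * S)) / 2 - Real.exp (-S ^ 2) / √2 * erf S +
    √(Real.pi / 2) * S * (erfc S * erfc (-S) / 2)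

lemma hasDerivAt_edgeClosedForm (S : ℝ) :
    HasDerivAt edgeClosedForm (√(2 * Real.pi) * (erfc S * erfc (-S) / 4)) S := by
  have h1 : HasDerivAt (fun S => erfc (-(√2 * S)) / 2)
      (-(2 / √Real.pi * Real.exp (-(-(√2 * S)) ^ 2)) * (-(√2 * 1)) / 2) S :=
    (HasDerivAt.comp (h₂ := erfc) S (hasDerivAt_erfc _)
      ((hasDerivAt_id S).const_mul √2).neg).div_const 2
  have h2 : HasDerivAt (fun S : ℝ => Real.exp (-S ^ 2) / √2)
      (Real.exp (-S ^ 2) * (-(2 * S)) / √2) S := by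
    have := ((hasDerivAt_pow 2 S).neg.exp).div_const √2
    simpa using this
  have h3 : HasDerivAt (fun S => erfc (-S)) (-(2 / √Real.pi * Real.exp (-(-S) ^ 2)) * (-1)) S :=
    HasDerivAt.comp (h₂ := erfc) S (hasDerivAt_erfc _) (hasDerivAt_id S).neg
  have h := (h1.sub (h2.mul (hasDerivAt_erf S))).add
    (((hasDerivAt_id S).const_mul √(Real.pi / 2)).mul (((hasDerivAt_erfc S).mul h3).div_const 2))
  refine h.congr_deriv ?_
  have e1 : Real.exp (-(-(√2 * S)) ^ 2) = Real.exp (-S ^ 2) * Real.exp (-S ^ 2) := by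
    rw [← Real.exp_add]; congr 1
    have : √2 ^ 2 = (2 : ℝ) := Real.sq_sqrt (by norm_num)
    rw [neg_sq, mul_pow, this]; ring
  have e2 : √(Real.pi / 2) = √Real.pi / √2 := Real.sqrt_div Real.pi_pos.le _
  have e3 : √(2 * Real.pi) = √2 * √Real.pi := Real.sqrt_mul (by norm_num) _
  have hp : √Real.pi ≠ 0 := by positivity
  have hs2 : √2 ^ 2 = (2 : ℝ) := Real.sq_sqrt (by norm_num)
  have h20 : √2 ≠ (0 : ℝ) := by positivity
  have e4 : erfc (-S) = 1 + erf S := by rw [erfc, erf_neg]; ring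
  have e5 : erfc S = 1 - erf S := rfl
  rw [e1]
  simp only [e2, e3, e4, e5, neg_sq, id, Pi.mul_apply]
  field_simp
  generalize √Real.pi = p at *
  generalize Real.exp (-S ^ 2) = E at *
  linear_combination (8 * E ^ 2 - 2 * p ^ 2 + 2 * p ^ 2 * erf S ^ 2) * hs2

lemma tendsto_exp_neg_sq_mul_erf {l : Filter ℝ} (hl : Tendsto (fun S : ℝ => S ^ 2) l atTop) :
    Tendsto (fun S => Real.exp (-S ^ 2) / √2 * erf S) l (𝓝 0) := by
  have h : Tendsto (fun S : ℝ => Real.exp (-S ^ 2)) l (𝓝 0) :=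
    Real.tendsto_exp_atBot.comp (tendsto_neg_atTop_atBot.comp hl)
  refine squeeze_zero_norm (fun S => ?_) h
  have h1 : |erf S| ≤ 1 := by
    have e : erf S = 1 - erfc S := by rw [erfc]; ring
    rw [abs_le, e]
    constructor <;> linarith [erfc_nonneg S, erfc_le_two S]
  have h2 : (1 : ℝ) ≤ √2 := Real.one_le_sqrt.2 (by norm_num)
  rw [norm_mul, norm_div, Real.norm_of_nonneg (Real.exp_pos _).le,
    Real.norm_of_nonneg (Real.sqrt_nonneg _), Real.norm_eq_abs]
  calc _ ≤ Real.exp (-S ^ 2) / 1 * 1 := by gcongr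
    _ = _ := by ring

lemma tendsto_edgeClosedForm_atTop : Tendsto edgeClosedForm atTop (𝓝 1) := by
  have h2 : (0 : ℝ) < √2 := by positivity
  have h1 : Tendsto (fun S => erfc (-(√2 * S)) / 2) atTop (𝓝 (2 / 2)) :=
    (tendsto_erfc_atBot.comp (tendsto_neg_atTop_atBot.comp
      (tendsto_id.const_mul_atTop h2))).div_const 2
  have h3 : Tendsto (fun S => √(Real.pi / 2) * S * (erfc S * erfc (-S) / 2)) atTop
      (𝓝 (√(Real.pi / 2) * (0 * 2 / 2))) := by
    have := ((tendsto_mul_erfc_atTop.mul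
      (tendsto_erfc_atBot.comp tendsto_neg_atTop_atBot)).div_const 2).const_mul √(Real.pi / 2)
    refine this.congr fun S => ?_
    simp only [Function.comp]; ring
  have h := (h1.sub (tendsto_exp_neg_sq_mul_erf (tendsto_pow_atTop two_ne_zero))).add h3
  rwa [show (2 : ℝ) / 2 - 0 + √(Real.pi / 2) * (0 * 2 / 2) = 1 by norm_num] at h

lemma tendsto_edgeClosedForm_atBot : Tendsto edgeClosedForm atBot (𝓝 0) := by
  have h2 : (0 : ℝ) < √2 := by positivity
  have h1 : Tendsto (fun S => erfc (-(√2 * S)) / 2) atBot (𝓝 (0 / 2)) :=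
    (tendsto_erfc_atTop.comp (tendsto_neg_atBot_atTop.comp
      (tendsto_id.const_mul_atBot h2))).div_const 2
  have h3 : Tendsto (fun S => √(Real.pi / 2) * S * (erfc S * erfc (-S) / 2)) atBot
      (𝓝 (-(√(Real.pi / 2) * (0 * 2 / 2)))) := by
    have := (((tendsto_mul_erfc_atTop.comp tendsto_neg_atBot_atTop).mul
      tendsto_erfc_atBot).div_const 2).const_mul √(Real.pi / 2) |>.neg
    refine this.congr fun S => ?_
    simp only [Function.comp]; ring
  have hsq : Tendsto (fun S : ℝ => S ^ 2) atBot atTop := by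
    refine ((tendsto_pow_atTop (two_ne_zero)).comp tendsto_neg_atBot_atTop).congr fun S => ?_
    simp
  have h := (h1.sub (tendsto_exp_neg_sq_mul_erf hsq)).add h3
  rwa [show (0 : ℝ) / 2 - 0 + -(√(Real.pi / 2) * (0 * 2 / 2)) = 0 by norm_num] at h

lemma edgeFunction_eq_edgeClosedForm (S : ℝ) : edgeFunction S = edgeClosedForm S := by
  rw [edgeFunction, ← integral_const_mul,
    integral_Iic_of_hasDerivAt_of_tendsto (f := edgeClosedForm) (m := 0)
      (hasDerivAt_edgeClosedForm S).continuousAt.continuousWithinAt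
      (fun x _ => hasDerivAt_edgeClosedForm x)
      (integrable_erfc_mul_erfc_neg.const_mul _).integrableOn tendsto_edgeClosedForm_atBot,
    sub_zero]

lemma integral_erfc_mul_erfc_neg :
    √(2 * Real.pi) * ∫ t, erfc t * erfc (-t) / 4 = 1 := by
  rw [← integral_const_mul, integral_of_hasDerivAt_of_tendsto hasDerivAt_edgeClosedForm
      (integrable_erfc_mul_erfc_neg.const_mul _) tendsto_edgeClosedForm_atBot
      tendsto_edgeClosedForm_atTop, sub_zero]

/-! ### Expansion of the joint densities in monomials -/

/-- `D` is a polynomial in `z_j` and `conj z_j` whose balanced monomials, those with the same power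
`m_j` of `z_j` and of `conj z_j` for every `j`, have `2 m_j = β (π j + 1) - 2` for a permutation `π`
of the indices. Moreover every monomial has degree at least `β - 2` in each pair
`(z_j, conj z_j)`, which is what makes it integrable near the origin. -/
def HasRadialExpansion (β N : ℕ) (D : (Fin N → ℂ) → ℂ) : Prop :=
  ∃ (ι : Type) (_ : Fintype ι) (c : ι → ℂ) (m n : ι → Fin N → ℕ),
    (∀ z, D z = ∑ i, c i * ∏ j, z j ^ m i j * conj (z j) ^ n i j) ∧
    (∀ i j, β ≤ m i j + n i j + 2) ∧
    ∀ i, m i = n i → ∃ π : Equiv.Perm (Fin N), ∀ j, m i j + n i j + 2 = β * (π j + 1)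

instance : SigmaFinite dA := by unfold dA; infer_instance

instance : dA.IsAddHaarMeasure := by
  unfold dA
  exact Measure.IsAddHaarMeasure.nnreal_smul _
    (inv_ne_zero (by simp [← NNReal.coe_ne_zero, Real.pi_ne_zero]))

lemma measurePreserving_rotation (u : Circle) : MeasurePreserving (rotation u) dA dA :=
  (LinearIsometryEquiv.measurePreserving (rotation u)).smul_measure _

lemma exists_circle_pow_mul_conj_pow_eq_neg_one {m n : ℕ} (h : m ≠ n) :
    ∃ u : Circle, (u : ℂ) ^ m * conj (u : ℂ) ^ n = -1 := by
  -- The phase is multiplied by `m - n`.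
  refine ⟨Circle.exp (Real.pi / ((m : ℝ) - n)), ?_⟩
  have h0 : ((m : ℂ) - n) ≠ 0 := sub_ne_zero.2 (by exact_mod_cast h)
  rw [Circle.coe_exp, ← Complex.exp_conj, ← Complex.exp_nat_mul, ← Complex.exp_nat_mul,
    ← Complex.exp_add, ← Complex.exp_pi_mul_I]
  congr 1
  simp only [map_mul, Complex.conj_ofReal, Complex.conj_I]
  push_cast
  field_simp
  ring

section Angular

variable {N : ℕ} {w : ℂ → ℝ}

lemma integrable_prod_monomial (m n : Fin N → ℕ) (hw : Measurable w)
    (hint : ∀ j, Integrable (fun z => ‖z‖ ^ (m j + n j) * w z) dA) :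
    Integrable (fun z : Fin N → ℂ => ∏ j, (z j ^ m j * conj (z j) ^ n j * (w (z j) : ℂ)))
      (Measure.pi fun _ => dA) := by
  refine Integrable.fintype_prod (f := fun j z => z ^ m j * conj z ^ n j * (w z : ℂ)) fun j => ?_
  refine (hint j).mono ?_ (Eventually.of_forall fun z => ?_)
  · have : Measurable fun z : ℂ => conj z := Complex.continuous_conj.measurable
    exact (by fun_prop : Measurable _).aestronglyMeasurable
  · simp [pow_add]

/-- A radial observable is orthogonal to an unbalanced monomial: a suitable rotation of one of the
variables changes the sign of the integrand. -/
lemma integral_radial_mul_monomial_eq_zero (m n : Fin N → ℕ) (hmn : m ≠ n) (hw : Measurable w)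
    (hrad : ∀ z z', ‖z‖ = ‖z'‖ → w z = w z')
    {F : (Fin N → ℂ) → ℝ} (hF : Measurable F)
    (hFrad : ∀ z z' : Fin N → ℂ, (∀ j, ‖z j‖ = ‖z' j‖) → F z = F z') :
    ∫ z, (F z : ℂ) * ∏ j, (z j ^ m j * conj (z j) ^ n j * (w (z j) : ℂ))
      ∂(Measure.pi fun _ : Fin N => dA) = 0 := by
  obtain ⟨j₀, hj₀⟩ := Function.ne_iff.1 hmn
  obtain ⟨u, hu⟩ := exists_circle_pow_mul_conj_pow_eq_neg_one hj₀
  set U : Fin N → Circle := fun j => if j = j₀ then u else 1 with hU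
  have hT : MeasurePreserving (fun (z : Fin N → ℂ) j => rotation (U j) (z j))
      (Measure.pi fun _ => dA) (Measure.pi fun _ => dA) :=
    measurePreserving_pi _ _ fun j => measurePreserving_rotation (U j)
  set G : (Fin N → ℂ) → ℂ :=
    fun z => (F z : ℂ) * ∏ j, (z j ^ m j * conj (z j) ^ n j * (w (z j) : ℂ)) with hG
  have hGm : Measurable G := by
    have : Measurable fun z : ℂ => conj z := Complex.continuous_conj.measurable
    fun_prop
  have hGT : ∀ z, G (fun j => rotation (U j) (z j)) = -G z := by
    intro z
    have h1 : F (fun j => rotation (U j) (z j)) = F z := hFrad _ _ fun j =>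
      LinearIsometryEquiv.norm_map _ _
    have h2 : ∀ j, w (rotation (U j) (z j)) = w (z j) := fun j =>
      hrad _ _ (LinearIsometryEquiv.norm_map _ _)
    have h3 : ∏ j, ((U j : ℂ) ^ m j * conj (U j : ℂ) ^ n j) = -1 := by
      rw [Finset.prod_eq_single j₀ (fun j _ hj => by simp [hU, hj]) (by simp)]
      simpa [hU] using hu
    simp only [hG, h1, h2]
    simp only [rotation_apply]
    rw [← neg_one_mul (_ * _), ← h3, mul_left_comm, ← Finset.prod_mul_distrib]
    congr 1
    refine Finset.prod_congr rfl fun j _ => ?_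
    rw [map_mul]
    ring
  have h : ∫ z, G z ∂(Measure.pi fun _ => dA) = -∫ z, G z ∂(Measure.pi fun _ => dA) := by
    conv_lhs => rw [← hT.map_eq, integral_map hT.measurable.aemeasurable
      hGm.aestronglyMeasurable]
    simp only [hGT, integral_neg]
  exact self_eq_neg.1 h

lemma integral_comp_perm (π : Equiv.Perm (Fin N)) {G : (Fin N → ℂ) → ℂ} (hG : Measurable G) :
    ∫ z, G (fun j => z (π j)) ∂(Measure.pi fun _ : Fin N => dA) =
      ∫ z, G z ∂(Measure.pi fun _ : Fin N => dA) := by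
  have hT : MeasurePreserving (fun (z : Fin N → ℂ) j => z (π j))
      (Measure.pi fun _ => dA) (Measure.pi fun _ => dA) := by
    have := measurePreserving_piCongrLeft (fun _ : Fin N => dA) π.symm
    convert this using 1
    ext z j
    simp [MeasurableEquiv.coe_piCongrLeft, Equiv.piCongrLeft_apply]
  conv_rhs => rw [← hT.map_eq, integral_map hT.measurable.aemeasurable hG.aestronglyMeasurable]

/-- Integrated against a symmetric radial observable, a density with a radial expansion is a
constant multiple of a product density; the constant is the sum of the coefficients of the balanced
monomials. -/
lemma HasRadialExpansion.exists_integral_eq {β : ℕ} {D : (Fin N → ℂ) → ℂ}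
    (hD : HasRadialExpansion β N D) (hw : Measurable w)
    (hrad : ∀ z z', ‖z‖ = ‖z'‖ → w z = w z')
    (hint : ∀ M, β ≤ M + 2 → Integrable (fun z => ‖z‖ ^ M * w z) dA) :
    ∃ C : ℂ, ∀ F : (Fin N → ℂ) → ℝ, Measurable F → (∃ K, ∀ z, |F z| ≤ K) →
      (∀ z z' : Fin N → ℂ, (∀ j, ‖z j‖ = ‖z' j‖) → F z = F z') →
      (∀ (π : Equiv.Perm (Fin N)) z, F (fun j => z (π j)) = F z) →
      ∫ z, (F z : ℂ) * (D z * ∏ j, (w (z j) : ℂ)) ∂(Measure.pi fun _ : Fin N => dA) =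
        C * ∫ z, (F z : ℂ) * ∏ j : Fin N, ((‖z j‖ ^ (β * (j + 1) - 2) * w (z j) : ℝ) : ℂ)
          ∂(Measure.pi fun _ : Fin N => dA) := by
  classical
  obtain ⟨ι, _, c, m, n, hD, hβmn, hπ⟩ := hD
  refine ⟨∑ i, if m i = n i then c i else 0, fun F hF ⟨K, hK⟩ hFrad hFsymm => ?_⟩
  have hI : ∀ i, Integrable (fun z : Fin N → ℂ => (F z : ℂ) *
      ∏ j, (z j ^ m i j * conj (z j) ^ n i j * (w (z j) : ℂ))) (Measure.pi fun _ => dA) := by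
    intro i
    refine (integrable_prod_monomial (m i) (n i) hw fun j => hint _ (hβmn i j)).bdd_mul (c := K)
      (by fun_prop) (Eventually.of_forall fun z => ?_)
    simpa using hK z
  have h1 : ∀ z, (F z : ℂ) * (D z * ∏ j, (w (z j) : ℂ)) = ∑ i, c i * ((F z : ℂ) *
      ∏ j, (z j ^ m i j * conj (z j) ^ n i j * (w (z j) : ℂ))) := by
    intro z
    rw [hD, Finset.sum_mul, Finset.mul_sum]
    refine Finset.sum_congr rfl fun i _ => ?_
    rw [Finset.prod_mul_distrib (g := fun j => (w (z j) : ℂ))]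
    ring
  simp_rw [h1]
  rw [integral_finsetSum _ fun i _ => (hI i).const_mul _, Finset.sum_mul]
  refine Finset.sum_congr rfl fun i _ => ?_
  rw [integral_const_mul]
  split_ifs with h
  · obtain ⟨π, hπ⟩ := hπ i h
    congr 1
    rw [← integral_comp_perm π]
    · refine integral_congr_ae (Eventually.of_forall fun z => ?_)
      simp only [hFsymm π z]
      congr 1
      rw [← Equiv.prod_comp π fun j => ((‖z j‖ ^ (β * (j + 1) - 2) * w (z j) : ℝ) : ℂ)]
      refine Finset.prod_congr rfl fun j _ => ?_
      have hm : β * (π j + 1) - 2 = 2 * m i j := by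
        have := hπ j
        rw [← h] at this
        omega
      rw [hm, ← h, ← mul_pow, Complex.mul_conj', pow_mul]
      push_cast
      ring
    · have : Measurable fun z : ℂ => conj z := Complex.continuous_conj.measurable
      fun_prop
  · rw [integral_radial_mul_monomial_eq_zero _ _ h hw hrad hF hFrad, mul_zero, zero_mul]

end Angular

lemma det_vandermonde_eq_sum_perm {n : ℕ} (v : Fin n → ℂ) :
    (Matrix.vandermonde v).det =
      ∑ σ : Equiv.Perm (Fin n), (Equiv.Perm.sign σ : ℂ) * ∏ i, v i ^ (σ i : ℕ) := by
  rw [← Matrix.det_transpose, Matrix.det_apply']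
  rfl

lemma det_vandermonde_eq_prod_Iio {n : ℕ} (v : Fin n → ℂ) :
    (Matrix.vandermonde v).det = ∏ j, ∏ k ∈ Finset.Iio j, (v j - v k) := by
  rw [Matrix.det_vandermonde]
  exact Finset.prod_comm' (by simp)

lemma ofReal_norm_sq (z : ℂ) : ((‖z‖ ^ 2 : ℝ) : ℂ) = z * conj z := by
  rw [Complex.mul_conj']; push_cast; rfl

lemma hasRadialExpansion_complex (N : ℕ) : HasRadialExpansion 2 N
    fun z => ((∏ j : Fin N, ∏ k ∈ Finset.Iio j, ‖z j - z k‖ ^ 2 : ℝ) : ℂ) := by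
  refine ⟨Equiv.Perm (Fin N) × Equiv.Perm (Fin N), inferInstance,
    fun p => (Equiv.Perm.sign p.1 : ℂ) * (Equiv.Perm.sign p.2 : ℂ),
    fun p j => p.1 j, fun p j => p.2 j, fun z => ?_, fun i j => by omega, fun p hp => ⟨p.1, ?_⟩⟩
  · have h : ((∏ j : Fin N, ∏ k ∈ Finset.Iio j, ‖z j - z k‖ ^ 2 : ℝ) : ℂ) =
        (Matrix.vandermonde z).det * conj (Matrix.vandermonde z).det := by
      rw [det_vandermonde_eq_prod_Iio]
      simp only [Complex.ofReal_prod, ofReal_norm_sq, map_prod, Finset.prod_mul_distrib]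
    beta_reduce
    rw [h, det_vandermonde_eq_sum_perm, map_sum, Finset.sum_mul_sum, Fintype.sum_prod_type]
    refine Finset.sum_congr rfl fun σ _ => Finset.sum_congr rfl fun τ _ => ?_
    simp only [map_mul, map_prod, map_pow, Finset.prod_mul_distrib]
    rw [show conj ((Equiv.Perm.sign τ : ℤ) : ℂ) = ((Equiv.Perm.sign τ : ℤ) : ℂ) from
      map_intCast _ _]
    ring
  · intro j
    have := congrFun hp j
    simp only at this ⊢
    omega

/-- If a permutation of `{0, …, 2N - 1}` maps each of the pairs `{j, N + j}` to two consecutive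
numbers, then these images are the pairs `{2i, 2i + 1}`, each taken once. -/
lemma exists_perm_of_adjacent {N : ℕ} (σ : Equiv.Perm (Fin (N + N)))
    (h : ∀ j : Fin N, (σ (Fin.castAdd N j) : ℕ) + 1 = σ (Fin.natAdd N j) ∨
      (σ (Fin.natAdd N j) : ℕ) + 1 = σ (Fin.castAdd N j)) :
    ∃ π : Equiv.Perm (Fin N), ∀ j,
      (σ (Fin.castAdd N j) : ℕ) + σ (Fin.natAdd N j) = 4 * π j + 1 := by
  set c : Fin N → ℕ := fun j => σ (Fin.castAdd N j) with hc
  set d : Fin N → ℕ := fun j => σ (Fin.natAdd N j) with hd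
  have hcc : ∀ j k, c j = c k → j = k := fun j k e =>
    Fin.castAdd_injective _ _ (σ.injective (Fin.ext e))
  have hdd : ∀ j k, d j = d k → j = k := fun j k e =>
    Fin.natAdd_injective _ _ (σ.injective (Fin.ext e))
  have hcd : ∀ j k, c j ≠ d k := fun j k e => by
    have := congrArg Fin.val (σ.injective (Fin.ext e))
    simp only [Fin.val_castAdd, Fin.val_natAdd] at this
    omega
  have hsurj : ∀ v < N + N, ∃ j, c j = v ∨ d j = v := by
    intro v hv
    have key : ∀ i : Fin (N + N), ∃ j, c j = σ i ∨ d j = σ i := fun i =>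
      Fin.addCases (fun j => ⟨j, Or.inl rfl⟩) (fun j => ⟨j, Or.inr rfl⟩) i
    obtain ⟨j, hj⟩ := key (σ.symm ⟨v, hv⟩)
    refine ⟨j, ?_⟩
    simpa using hj
  have hlt : ∀ j, c j < N + N ∧ d j < N + N := fun j => ⟨(σ _).2, (σ _).2⟩
  have h' : ∀ j, c j + 1 = d j ∨ d j + 1 = c j := h
  -- The smaller member of each pair is even: below an odd one there would be another odd one.
  have heven : ∀ v j, min (c j) (d j) = v → v % 2 = 0 := by
    intro v
    induction v using Nat.strong_induction_on with
    | _ v ih =>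
      intro j hj
      by_contra hodd
      obtain ⟨k, hk⟩ := hsurj (v - 1) (by have := hlt j; omega)
      have hjk : k ≠ j := by rintro rfl; have := h' k; omega
      have h1 : c j ≠ c k := fun e => hjk (hcc _ _ e).symm
      have h2 : d j ≠ d k := fun e => hjk (hdd _ _ e).symm
      have h3 := hcd j k
      have h4 := hcd k j
      have := h' k
      have := h' j
      have := ih (v - 2) (by omega) k (by omega)
      omega
  have hinj : Function.Injective fun j : Fin N =>
      (⟨min (c j) (d j) / 2, by have := hlt j; have := h' j; omega⟩ : Fin N) := by
    intro j k hjk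
    have e := congrArg Fin.val hjk
    simp only at e
    by_contra hne
    have h1 : c j ≠ c k := fun e => hne (hcc _ _ e)
    have h2 : d j ≠ d k := fun e => hne (hdd _ _ e)
    have h3 := hcd j k
    have h4 := hcd k j
    have := heven _ j rfl
    have := heven _ k rfl
    omega
  refine ⟨Equiv.ofBijective _ (Finite.injective_iff_bijective.1 hinj), fun j => ?_⟩
  have := heven _ j rfl
  have := h' j
  change c j + d j = 4 * (min (c j) (d j) / 2) + 1
  omega

lemma det_vandermonde_append_conj {N : ℕ} (z : Fin N → ℂ) :
    (Matrix.vandermonde (Fin.append z fun j => conj (z j))).det =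
      (∏ j : Fin N, ∏ _k ∈ Finset.Iio j, (-1 : ℂ)) *
      ((∏ j : Fin N, ∏ k ∈ Finset.Iio j,
        (((‖z j - z k‖ ^ 2 * ‖z j - conj (z k)‖ ^ 2 : ℝ)) : ℂ)) *
          ∏ j, (conj (z j) - z j)) := by
  rw [det_vandermonde_eq_prod_Iio]
  have hIio : ∀ (n : ℕ) (f : Fin n → Fin n → ℂ), ∏ j, ∏ k ∈ Finset.Iio j, f j k =
      ∏ j, ∏ k, if k < j then f j k else 1 := by
    intro n f
    refine Finset.prod_congr rfl fun j _ => ?_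
    rw [← Finset.prod_filter]
    congr 1
    ext k; simp
  have hdiag : ∏ j, (conj (z j) - z j) = ∏ j, ∏ k, if k = j then (conj (z j) - z k) else 1 := by
    refine Finset.prod_congr rfl fun j _ => ?_
    simp
  have hswap : ∏ j, ∏ k, (if j < k then (conj (z j) - z k) else 1) =
      ∏ j, ∏ k, (if k < j then (conj (z k) - z j) else 1) := Finset.prod_comm
  have hsplit : ∏ j, ∏ k, (conj (z j) - z k) =
      (∏ j, ∏ k, if k < j then (conj (z j) - z k) else 1) *
      ((∏ j, ∏ k, if k = j then (conj (z j) - z k) else 1) *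
        ∏ j, ∏ k, (if j < k then (conj (z j) - z k) else 1)) := by
    simp only [← Finset.prod_mul_distrib]
    refine Finset.prod_congr rfl fun j _ => Finset.prod_congr rfl fun k _ => ?_
    rcases lt_trichotomy k j with h | h | h
    · simp [h, h.ne, h.not_gt]
    · simp [h]
    · simp [h, h.ne', h.not_gt]
  have hlt1 : ∀ j k : Fin N, ¬ Fin.natAdd N k < Fin.castAdd N j := fun j k => by
    simp only [Fin.lt_def, Fin.val_natAdd, Fin.val_castAdd]; omega
  have hlt2 : ∀ j k : Fin N, Fin.castAdd N k < Fin.natAdd N j := fun j k => by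
    simp only [Fin.lt_def, Fin.val_natAdd, Fin.val_castAdd]; omega
  have hlt3 : ∀ j k : Fin N, Fin.castAdd N k < Fin.castAdd N j ↔ k < j := fun j k => by
    simp only [Fin.lt_def, Fin.val_castAdd]
  have hlt4 : ∀ j k : Fin N, Fin.natAdd N k < Fin.natAdd N j ↔ k < j := fun j k => by
    simp only [Fin.lt_def, Fin.val_natAdd]; omega
  simp only [hIio, Fin.prod_univ_add, hlt1, hlt2, hlt3, hlt4, Fin.append_left, Fin.append_right,
    if_true, if_false, Finset.prod_const_one, one_mul, Finset.prod_mul_distrib (s := Finset.univ)]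
  rw [hsplit, hdiag, hswap]
  have hcomb : ∀ A B C D E F G : ℂ, A * B * C * D = E * F →
      (A * (B * (G * C))) * D = E * (F * G) := by
    intro A B C D E F G h
    linear_combination G * h
  refine hcomb _ _ _ _ _ _ _ ?_
  simp only [← Finset.prod_mul_distrib]
  refine Finset.prod_congr rfl fun j _ => Finset.prod_congr rfl fun k _ => ?_
  split_ifs
  · rw [Complex.ofReal_mul, ofReal_norm_sq, ofReal_norm_sq]
    simp only [map_sub, Complex.conj_conj]
    ring
  · simp

lemma hasRadialExpansion_symplectic (N : ℕ) : HasRadialExpansion 4 N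
    fun z => (((∏ j : Fin N, ∏ k ∈ Finset.Iio j, ‖z j - z k‖ ^ 2 * ‖z j - conj (z k)‖ ^ 2) *
      ∏ j, ‖z j - conj (z j)‖ ^ 2 : ℝ) : ℂ) := by
  -- The sign relating the density to the Vandermonde determinant.
  set ε : ℂ := ∏ j : Fin N, ∏ _k ∈ Finset.Iio j, (-1 : ℂ) with hε
  have hεε : ε * ε = 1 := by
    simp only [hε, ← Finset.prod_mul_distrib]
    simp
  refine ⟨Equiv.Perm (Fin (N + N)) × (Fin N → Bool), inferInstance,
    fun p => ε * ((Equiv.Perm.sign p.1 : ℂ) * ∏ j, if p.2 j then (1 : ℂ) else -1),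
    fun p j => p.1 (Fin.castAdd N j) + if p.2 j then 1 else 0,
    fun p j => p.1 (Fin.natAdd N j) + if p.2 j then 0 else 1, fun z => ?_, fun p j => ?_,
    fun p hp => ?_⟩
  · have h : (((∏ j : Fin N, ∏ k ∈ Finset.Iio j, ‖z j - z k‖ ^ 2 * ‖z j - conj (z k)‖ ^ 2) *
        ∏ j, ‖z j - conj (z j)‖ ^ 2 : ℝ) : ℂ) =
        ε * ((Matrix.vandermonde (Fin.append z fun j => conj (z j))).det *
          ∏ j, (z j - conj (z j))) := by
      have hd : ((∏ j, ‖z j - conj (z j)‖ ^ 2 : ℝ) : ℂ) =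
          (∏ j, (z j - conj (z j))) * ∏ j, (conj (z j) - z j) := by
        simp only [Complex.ofReal_prod, ofReal_norm_sq, map_sub, Complex.conj_conj,
          Finset.prod_mul_distrib]
      rw [det_vandermonde_append_conj, ← hε, Complex.ofReal_mul, hd]
      simp only [Complex.ofReal_prod]
      linear_combination (-(∏ j : Fin N, ∏ k ∈ Finset.Iio j,
        (((‖z j - z k‖ ^ 2 * ‖z j - conj (z k)‖ ^ 2 : ℝ)) : ℂ)) *
        (∏ j, (z j - conj (z j))) * ∏ j, (conj (z j) - z j)) * hεε
    have h2 : ∏ j, (z j - conj (z j)) = ∑ t : Fin N → Bool,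
        ∏ j, if t j then z j else - conj (z j) := by
      have : ∀ j, z j - conj (z j) = ∑ b : Bool, if b then z j else - conj (z j) := by
        intro j; simp [sub_eq_add_neg]
      simp only [this]
      rw [Finset.prod_univ_sum, Fintype.piFinset_univ]
    beta_reduce
    rw [h, h2, det_vandermonde_eq_sum_perm, Finset.sum_mul_sum, Fintype.sum_prod_type,
      Finset.mul_sum]
    refine Finset.sum_congr rfl fun σ _ => ?_
    rw [Finset.mul_sum]
    refine Finset.sum_congr rfl fun t _ => ?_
    rw [Fin.prod_univ_add]
    simp only [Fin.append_left, Fin.append_right]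
    rw [← Finset.prod_mul_distrib, mul_assoc, mul_assoc, mul_assoc, ← Finset.prod_mul_distrib,
      ← Finset.prod_mul_distrib]
    congr 3
    ext j
    split_ifs <;> ring
  · have hne : (p.1 (Fin.castAdd N j) : ℕ) ≠ p.1 (Fin.natAdd N j) := fun e => by
      have := congrArg Fin.val (p.1.injective (Fin.ext e))
      simp only [Fin.val_castAdd, Fin.val_natAdd] at this
      omega
    simp only
    split_ifs <;> omega
  · have hadj : ∀ j, (p.1 (Fin.castAdd N j) : ℕ) + 1 = p.1 (Fin.natAdd N j) ∨
        (p.1 (Fin.natAdd N j) : ℕ) + 1 = p.1 (Fin.castAdd N j) := by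
      intro j
      have := congrFun hp j
      simp only at this
      split_ifs at this <;> omega
    obtain ⟨π, hπ⟩ := exists_perm_of_adjacent p.1 hadj
    refine ⟨π, fun j => ?_⟩
    have := hπ j
    simp only
    split_ifs <;> omega

/-! ### The number variance as a sum of Bernoulli variances -/

lemma HasRadialExpansion.integrable {β N : ℕ} {D : (Fin N → ℂ) → ℂ} {w : ℂ → ℝ}
    (hD : HasRadialExpansion β N D) (hw : Measurable w)
    (hint : ∀ M, β ≤ M + 2 → Integrable (fun z => ‖z‖ ^ M * w z) dA) :
    Integrable (fun z => D z * ∏ j, (w (z j) : ℂ)) (Measure.pi fun _ : Fin N => dA) := by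
  obtain ⟨ι, _, c, m, n, hD, hβmn, -⟩ := hD
  have h1 : ∀ z, D z * ∏ j, (w (z j) : ℂ) = ∑ i, c i *
      ∏ j, (z j ^ m i j * conj (z j) ^ n i j * (w (z j) : ℂ)) := by
    intro z
    rw [hD, Finset.sum_mul]
    refine Finset.sum_congr rfl fun i _ => ?_
    rw [Finset.prod_mul_distrib (g := fun j => (w (z j) : ℂ))]
    ring
  simp_rw [h1]
  exact integrable_finsetSum _ fun i _ =>
    (integrable_prod_monomial (m i) (n i) hw fun j => hint _ (hβmn i j)).const_mul _

/-- The polynomial factor of the joint density. It is positive at some point, which makes the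
partition function positive. -/
lemma exists_jointDensity_eq {β : ℕ} (hβ : β = 2 ∨ β = 4) (N : ℕ) :
    ∃ P : (Fin N → ℂ) → ℝ, Continuous P ∧ (∀ z, 0 ≤ P z) ∧ (∃ z, 0 < P z) ∧
      HasRadialExpansion β N (fun z => (P z : ℂ)) ∧
      ∀ g z, jointDensity β N g z = P z * ∏ j, Real.exp (-(N : ℝ) * g ‖z j‖) := by
  have hconj : Continuous fun z : ℂ => conj z := Complex.continuous_conj
  have hre : ∀ j k : Fin N, k ≠ j → ((j : ℝ) + 1) - ((k : ℝ) + 1) ≠ 0 := fun j k h e => by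
    refine h (Fin.ext ?_)
    have : (k : ℝ) = j := by linarith
    exact_mod_cast this
  rcases hβ with rfl | rfl
  · refine ⟨fun z => ∏ j : Fin N, ∏ k ∈ Finset.Iio j, ‖z j - z k‖ ^ 2, by fun_prop,
      fun z => by positivity, ⟨fun j => ((j : ℝ) + 1 : ℝ), ?_⟩, hasRadialExpansion_complex N,
      fun g z => ?_⟩
    · refine Finset.prod_pos fun j _ => Finset.prod_pos fun k hk => ?_
      have := hre j k (Finset.mem_Iio.1 hk).ne
      rw [← Complex.ofReal_sub, Complex.norm_real]
      positivity
    · simp [jointDensity, complexDensity]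
  · refine ⟨fun z => (∏ j : Fin N, ∏ k ∈ Finset.Iio j,
      ‖z j - z k‖ ^ 2 * ‖z j - conj (z k)‖ ^ 2) * ∏ j, ‖z j - conj (z j)‖ ^ 2, by fun_prop,
      fun z => by positivity, ⟨fun j => ((j : ℝ) + 1 : ℝ) * Complex.I, ?_⟩,
      hasRadialExpansion_symplectic N, fun g z => ?_⟩
    · have h2 : ∀ j k : Fin N, ((j : ℝ) + 1) + ((k : ℝ) + 1) ≠ 0 := fun j k => by positivity
      have e : ∀ j k : Fin N, ‖(((j : ℝ) + 1 : ℝ) * Complex.I : ℂ) -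
          conj (((k : ℝ) + 1 : ℝ) * Complex.I : ℂ)‖ = |((j : ℝ) + 1) + ((k : ℝ) + 1)| := by
        intro j k
        rw [map_mul, Complex.conj_I, Complex.conj_ofReal,
          show (((j : ℝ) + 1 : ℝ) * Complex.I : ℂ) - (((k : ℝ) + 1 : ℝ)) * -Complex.I =
            ((((j : ℝ) + 1) + ((k : ℝ) + 1) : ℝ)) * Complex.I by push_cast; ring, norm_mul,
          Complex.norm_real, Complex.norm_I, mul_one, Real.norm_eq_abs]
      refine mul_pos (Finset.prod_pos fun j _ => Finset.prod_pos fun k hk => ?_)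
        (Finset.prod_pos fun j _ => ?_)
      · have := hre j k (Finset.mem_Iio.1 hk).ne
        have := h2 j k
        rw [e, ← sub_mul, norm_mul, Complex.norm_I, ← Complex.ofReal_sub, Complex.norm_real]
        positivity
      · have := h2 j j
        rw [e]
        positivity
    · simp only [jointDensity, show ¬ (4 = 2) by norm_num, if_false, symplecticDensity,
        Finset.prod_mul_distrib]
      ring

lemma pi_withDensity_ofReal {ι : Type*} [Fintype ι] {E : Type*} [MeasurableSpace E]
    {μ : Measure E} [SigmaFinite μ] {f : ι → E → ℝ} (hf : ∀ i, Integrable (f i) μ)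
    (hf0 : ∀ i x, 0 ≤ f i x) :
    (Measure.pi fun _ : ι => μ).withDensity (fun z => ENNReal.ofReal (∏ i, f i (z i))) =
      Measure.pi fun i => μ.withDensity fun x => ENNReal.ofReal (f i x) := by
  have hfin : ∀ i, IsFiniteMeasure (μ.withDensity fun x => ENNReal.ofReal (f i x)) :=
    fun i => isFiniteMeasure_withDensity_ofReal (hf i).2
  symm
  refine Measure.pi_eq fun s hs => ?_
  have hS : MeasurableSet (univ.pi s) := MeasurableSet.univ_pi hs
  have hind : ∀ z : ι → E, (univ.pi s).indicator (fun z => ∏ i, f i (z i)) z =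
      ∏ i, (s i).indicator (f i) (z i) := by
    intro z
    by_cases hz : z ∈ univ.pi s
    · rw [indicator_of_mem hz]
      exact Finset.prod_congr rfl fun i _ => (indicator_of_mem (hz i (mem_univ i)) _).symm
    · rw [indicator_of_notMem hz]
      simp only [mem_univ_pi, not_forall] at hz
      obtain ⟨i, hi⟩ := hz
      exact (Finset.prod_eq_zero (Finset.mem_univ i) (indicator_of_notMem hi _)).symm
  have hint := Integrable.fintype_prod (μ := fun _ : ι => μ) hf
  rw [withDensity_apply _ hS, ← ofReal_integral_eq_lintegral_ofReal hint.integrableOn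
    (Eventually.of_forall fun z => Finset.prod_nonneg fun i _ => hf0 i _),
    ← integral_indicator hS]
  simp_rw [hind]
  rw [integral_fintype_prod_eq_prod (fun i x => (s i).indicator (f i) x),
    ENNReal.ofReal_prod_of_nonneg fun i _ => integral_nonneg fun x =>
      indicator_nonneg (fun x _ => hf0 i x) x]
  refine Finset.prod_congr rfl fun i _ => ?_
  rw [withDensity_apply _ (hs i), integral_indicator (hs i),
    ofReal_integral_eq_lintegral_ofReal (hf i).integrableOn (Eventually.of_forall (hf0 i))]

lemma variance_indicator_one {E : Type*} [MeasurableSpace E] {ν : Measure E}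
    [IsProbabilityMeasure ν] {B : Set E} (hB : MeasurableSet B) :
    ProbabilityTheory.variance (B.indicator fun _ => (1 : ℝ)) ν = ν.real B * ν.real Bᶜ := by
  have hX : MemLp (B.indicator fun _ => (1 : ℝ)) 2 ν := (memLp_const 1).indicator hB
  have h2 : (B.indicator fun _ => (1 : ℝ)) ^ 2 = B.indicator fun _ => (1 : ℝ) := by
    ext x
    by_cases hx : x ∈ B <;> simp [hx]
  rw [ProbabilityTheory.variance_eq_sub hX, h2, integral_indicator_const _ hB,
    probReal_compl_eq_one_sub hB]
  simp
  ring

lemma diskCount_eq_sum_indicator (N : ℕ) (a : ℝ) :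
    diskCount N a = ∑ j : Fin N, fun z : Fin N → ℂ =>
      {x : ℂ | ‖x‖ < a}.indicator (fun _ => (1 : ℝ)) (z j) := by
  ext z
  rw [diskCount, Finset.sum_apply, Finset.card_filter]
  push_cast
  refine Finset.sum_congr rfl fun j _ => ?_
  simp [indicator_apply]

lemma measurable_diskCount (N : ℕ) (a : ℝ) : Measurable (diskCount N a) := by
  have hB : MeasurableSet {x : ℂ | ‖x‖ < a} := measurableSet_lt measurable_norm measurable_const
  rw [diskCount_eq_sum_indicator]
  have h : ∀ j : Fin N, Measurable fun z : Fin N → ℂ =>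
      {x : ℂ | ‖x‖ < a}.indicator (fun _ => (1 : ℝ)) (z j) :=
    fun j => (measurable_const.indicator hB).comp (measurable_pi_apply j)
  rw [Finset.sum_fn]
  exact Finset.measurable_sum _ fun j _ => h j

lemma diskCount_congr {N : ℕ} (a : ℝ) {z z' : Fin N → ℂ} (h : ∀ j, ‖z j‖ = ‖z' j‖) :
    diskCount N a z = diskCount N a z' := by
  simp only [diskCount, h]

lemma diskCount_comp_perm {N : ℕ} (a : ℝ) (π : Equiv.Perm (Fin N)) (z : Fin N → ℂ) :
    diskCount N a (fun j => z (π j)) = diskCount N a z := by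
  simp only [diskCount, Finset.card_filter]
  push_cast
  exact Equiv.sum_comp π fun j => if ‖z j‖ < a then (1 : ℝ) else 0

lemma abs_diskCount_le (N : ℕ) (a : ℝ) (z : Fin N → ℂ) : |diskCount N a z| ≤ N := by
  rw [diskCount, Nat.abs_cast]
  exact_mod_cast (Finset.card_filter_le _ _).trans (by simp)

/-- For symmetric radial observables the points may be taken independent, the `k`-th one with
density proportional to `|z|^{β (k + 1) - 2} e^{-N g(|z|)}`. -/
lemma exists_law_integral_eq {β N : ℕ} (hβ : β = 2 ∨ β = 4) {g : ℝ → ℝ}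
    (hg : Measurable fun z : ℂ => g ‖z‖)
    (hint : ∀ M, β ≤ M + 2 → Integrable (fun z => ‖z‖ ^ M * Real.exp (-(N : ℝ) * g ‖z‖)) dA) :
    ∃ ν : Fin N → Measure ℂ, (∀ k, IsProbabilityMeasure (ν k)) ∧
      (∀ (k : Fin N) (B : Set ℂ), MeasurableSet B → (ν k).real B =
        (∫ z in B, ‖z‖ ^ (β * (k + 1) - 2) * Real.exp (-(N : ℝ) * g ‖z‖) ∂dA) /
          ∫ z, ‖z‖ ^ (β * (k + 1) - 2) * Real.exp (-(N : ℝ) * g ‖z‖) ∂dA) ∧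
      ∀ F : (Fin N → ℂ) → ℝ, Measurable F → (∃ K, ∀ z, |F z| ≤ K) →
        (∀ z z' : Fin N → ℂ, (∀ j, ‖z j‖ = ‖z' j‖) → F z = F z') →
        (∀ (π : Equiv.Perm (Fin N)) z, F (fun j => z (π j)) = F z) →
        ∫ z, F z ∂(law β N g) = ∫ z, F z ∂(Measure.pi ν) := by
  obtain ⟨P, hPc, hP0, ⟨z₀, hz₀⟩, hP, hdens⟩ := exists_jointDensity_eq hβ N
  set w : ℂ → ℝ := fun z => Real.exp (-(N : ℝ) * g ‖z‖) with hw
  have hwm : Measurable w := Real.measurable_exp.comp (hg.const_mul _)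
  have hw0 : ∀ z, 0 < w z := fun z => Real.exp_pos _
  have hβ2 : 2 ≤ β := by omega
  set f : Fin N → ℂ → ℝ := fun k z => ‖z‖ ^ (β * (k + 1) - 2) * w z with hf
  have hfint : ∀ k, Integrable (f k) dA := fun k => hint _ (by
    have : β ≤ β * (k + 1) := Nat.le_mul_of_pos_right _ (by omega)
    omega)
  have hf0 : ∀ k z, 0 ≤ f k z := fun k z => mul_nonneg (by positivity) (hw0 z).le
  set Z : Fin N → ℝ := fun k => ∫ z, f k z ∂dA with hZ
  set μ : Measure (Fin N → ℂ) := Measure.pi fun _ : Fin N => dA with hμ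
  obtain ⟨C, hC⟩ := hP.exists_integral_eq hwm (fun z z' h => by simp only [hw, h]) hint
  set dens : (Fin N → ℂ) → ℝ := fun z => P z * ∏ j, w (z j) with hdens'
  have hdm : Measurable dens := by fun_prop
  have hd0 : ∀ z, 0 ≤ dens z := fun z =>
    mul_nonneg (hP0 z) (Finset.prod_nonneg fun j _ => (hw0 _).le)
  have hdint : Integrable dens μ := by
    have h := (hP.integrable hwm hint).re
    refine h.congr (Eventually.of_forall fun z => ?_)
    simp only [hdens', ← Complex.ofReal_prod, ← Complex.ofReal_mul]
    exact Complex.ofReal_re _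
  -- The identity of `HasRadialExpansion.exists_integral_eq` in terms of real integrals.
  have hreal : ∀ F : (Fin N → ℂ) → ℝ, Measurable F → (∃ K, ∀ z, |F z| ≤ K) →
      (∀ z z' : Fin N → ℂ, (∀ j, ‖z j‖ = ‖z' j‖) → F z = F z') →
      (∀ (π : Equiv.Perm (Fin N)) z, F (fun j => z (π j)) = F z) →
      ∫ z, F z * dens z ∂μ = C.re * ∫ z, F z * ∏ k, f k (z k) ∂μ := by
    intro F h1 h2 h3 h4
    have h := congrArg Complex.re (hC F h1 h2 h3 h4)
    have e1 : ∀ z, (F z : ℂ) * ((P z : ℂ) * ∏ j, (w (z j) : ℂ)) = ((F z * dens z : ℝ) : ℂ) := by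
      intro z; simp only [hdens']; push_cast; ring
    have e2 : ∀ z : Fin N → ℂ, (F z : ℂ) *
        ∏ j : Fin N, ((‖z j‖ ^ (β * (j + 1) - 2) * w (z j) : ℝ) : ℂ) =
        ((F z * ∏ k, f k (z k) : ℝ) : ℂ) := by
      intro z; simp only [hf]; push_cast; ring
    simp_rw [e1, e2] at h
    rw [integral_complex_ofReal, integral_complex_ofReal, Complex.re_mul_ofReal,
      Complex.ofReal_re] at h
    exact h
  have hZprod : ∫ z, ∏ k, f k (z k) ∂μ = ∏ k, Z k := integral_fintype_prod_eq_prod _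
  have hpos : 0 < ∫ z, dens z ∂μ := by
    rw [integral_pos_iff_support_of_nonneg hd0 hdint]
    refine ((isOpen_lt continuous_const hPc).measure_pos μ ⟨z₀, hz₀⟩).trans_le (measure_mono ?_)
    intro z hz
    exact (mul_pos hz (Finset.prod_pos fun j _ => hw0 _)).ne'
  have hpart : ∫ z, dens z ∂μ = C.re * ∏ k, Z k := by
    have := hreal (fun _ => 1) measurable_const ⟨1, by simp⟩ (by simp) (by simp)
    simpa [hZprod] using this
  have hC0 : C.re ≠ 0 := fun h => by rw [hpart, h, zero_mul] at hpos; exact hpos.false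
  have hZ0 : ∀ k, 0 < Z k := fun k => by
    refine lt_of_le_of_ne (integral_nonneg (hf0 k)) fun h => ?_
    rw [hpart, Finset.prod_eq_zero (Finset.mem_univ k) h.symm, mul_zero] at hpos
    exact hpos.false
  refine ⟨fun k => dA.withDensity fun z => ENNReal.ofReal (f k z / Z k), fun k => ⟨?_⟩,
    fun k B hB => ?_, fun F h1 h2 h3 h4 => ?_⟩
  · rw [withDensity_apply _ MeasurableSet.univ, Measure.restrict_univ,
      ← ofReal_integral_eq_lintegral_ofReal ((hfint k).div_const _)
        (Eventually.of_forall fun z => div_nonneg (hf0 k z) (hZ0 k).le), integral_div,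
      div_self (hZ0 k).ne', ENNReal.ofReal_one]
  · rw [measureReal_def, withDensity_apply _ hB,
      ← ofReal_integral_eq_lintegral_ofReal ((hfint k).div_const _).integrableOn
        (Eventually.of_forall fun z => div_nonneg (hf0 k z) (hZ0 k).le), integral_div,
      ENNReal.toReal_ofReal (div_nonneg (integral_nonneg (hf0 k)) (hZ0 k).le)]
  · have hjd : ∀ z, jointDensity β N g z = dens z := hdens g
    have hpf : partitionFunction β N g = ENNReal.ofReal (∫ z, dens z ∂μ) := by
      rw [ofReal_integral_eq_lintegral_ofReal hdint (Eventually.of_forall hd0), partitionFunction]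
      simp_rw [hjd]
      rfl
    rw [law, weightMeasure, integral_smul_measure]
    simp_rw [hjd]
    rw [integral_withDensity_eq_integral_toReal_smul (by fun_prop)
      (Eventually.of_forall fun z => ENNReal.ofReal_lt_top)]
    rw [← pi_withDensity_ofReal (fun k => (hfint k).div_const _)
      (fun k z => div_nonneg (hf0 k z) (hZ0 k).le),
      integral_withDensity_eq_integral_toReal_smul
        (by have : ∀ k, Measurable (f k) := fun k => by fun_prop
            fun_prop)
        (Eventually.of_forall fun z => ENNReal.ofReal_lt_top)]
    have e1 : ∀ z, (ENNReal.ofReal (dens z)).toReal • F z = F z * dens z := fun z => by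
      rw [ENNReal.toReal_ofReal (hd0 z), smul_eq_mul, mul_comm]
    have e2 : ∀ z : Fin N → ℂ, (ENNReal.ofReal (∏ k, (f k (z k) / Z k))).toReal • F z =
        (F z * ∏ k, f k (z k)) / ∏ k, Z k := fun z => by
      rw [ENNReal.toReal_ofReal (Finset.prod_nonneg fun k _ => div_nonneg (hf0 k _) (hZ0 k).le),
        smul_eq_mul, Finset.prod_div_distrib]
      ring
    simp_rw [e1, e2]
    rw [integral_div, hreal F h1 h2 h3 h4, hpf, hpart, ENNReal.toReal_inv,
      ENNReal.toReal_ofReal (by rw [← hpart]; exact hpos.le), smul_eq_mul]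
    have : ∏ k, Z k ≠ 0 := (Finset.prod_pos fun k _ => hZ0 k).ne'
    field_simp
    rfl

lemma numberVariance_eq_sum_measureReal {β N : ℕ} {g : ℝ → ℝ} {ν : Fin N → Measure ℂ}
    (hν : ∀ k, IsProbabilityMeasure (ν k))
    (h : ∀ F : (Fin N → ℂ) → ℝ, Measurable F → (∃ K, ∀ z, |F z| ≤ K) →
        (∀ z z' : Fin N → ℂ, (∀ j, ‖z j‖ = ‖z' j‖) → F z = F z') →
        (∀ (π : Equiv.Perm (Fin N)) z, F (fun j => z (π j)) = F z) →
        ∫ z, F z ∂(law β N g) = ∫ z, F z ∂(Measure.pi ν)) (a : ℝ) :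
    numberVariance β N g a = ∑ k, (ν k).real {z | ‖z‖ < a} * (ν k).real {z | ‖z‖ < a}ᶜ := by
  have hB : MeasurableSet {x : ℂ | ‖x‖ < a} := measurableSet_lt measurable_norm measurable_const
  have hm := measurable_diskCount N a
  have h1 : ∫ z, diskCount N a z ∂(law β N g) = ∫ z, diskCount N a z ∂(Measure.pi ν) :=
    h _ hm ⟨N, abs_diskCount_le N a⟩ (fun z z' h => diskCount_congr a h) (diskCount_comp_perm a)
  have h2 : numberVariance β N g a = ProbabilityTheory.variance (diskCount N a) (Measure.pi ν) := by
    rw [numberVariance, ProbabilityTheory.variance_eq_integral hm.aemeasurable,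
      ProbabilityTheory.variance_eq_integral hm.aemeasurable, h1]
    set m := ∫ z, diskCount N a z ∂(Measure.pi ν)
    refine h _ (by fun_prop) ⟨(N + |m|) ^ 2, fun z => ?_⟩
      (fun z z' h => by rw [diskCount_congr a h]) (fun π z => by rw [diskCount_comp_perm])
    rw [abs_pow]
    gcongr
    exact (abs_sub _ _).trans (by gcongr; exact abs_diskCount_le N a z)
  rw [h2, diskCount_eq_sum_indicator, ProbabilityTheory.variance_sum_pi
    (X := fun _ => {x : ℂ | ‖x‖ < a}.indicator fun _ => (1 : ℝ))
    (fun k => (memLp_const 1).indicator hB)]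
  exact Finset.sum_congr rfl fun k _ => variance_indicator_one hB

lemma integrable_norm_pow_mul_iff (M : ℕ) (φ : ℝ → ℝ) :
    Integrable (fun z : ℂ => ‖z‖ ^ M * φ ‖z‖) dA ↔
      IntegrableOn (fun r => r ^ (M + 1) * φ r) (Ioi 0) := by
  rw [integrable_fun_norm_addHaar dA (f := fun r => r ^ M * φ r), Complex.finrank_real_complex]
  refine integrable_congr (Eventually.of_forall fun r => ?_)
  simp only [smul_eq_mul]
  ring

lemma exists_setIntegral_norm_pow_mul_eq : ∃ κ : ℝ, 0 < κ ∧
    ∀ (M : ℕ) (φ : ℝ → ℝ) (s : Set ℝ), MeasurableSet s →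
      ∫ z in {z : ℂ | ‖z‖ ∈ s}, ‖z‖ ^ M * φ ‖z‖ ∂dA =
        κ * ∫ r in Ioi 0 ∩ s, r ^ (M + 1) * φ r := by
  refine ⟨2 * dA.real (Metric.ball (0 : ℂ) 1), ?_, fun M φ s hs => ?_⟩
  · have : 0 < dA.real (Metric.ball (0 : ℂ) 1) :=
      ENNReal.toReal_pos (Metric.measure_ball_pos _ _ one_pos).ne' measure_ball_lt_top.ne
    positivity
  · rw [← integral_indicator (s := {z : ℂ | ‖z‖ ∈ s}) (hs.preimage measurable_norm)]
    have h := integral_fun_norm_addHaar dA (E := ℂ) (s.indicator fun r => r ^ M * φ r)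
    rw [Complex.finrank_real_complex] at h
    have e1 : ∀ z : ℂ, {z : ℂ | ‖z‖ ∈ s}.indicator (fun z => ‖z‖ ^ M * φ ‖z‖) z =
        s.indicator (fun r => r ^ M * φ r) ‖z‖ := fun z => rfl
    simp_rw [e1]
    rw [h, ← setIntegral_indicator hs]
    simp only [nsmul_eq_mul, smul_eq_mul]
    push_cast
    rw [mul_assoc]
    congr 3
    ext r
    by_cases hr : r ∈ s
    · simp [hr]; ring
    · simp [hr]

/-- The number variance is the sum of the Bernoulli variances `p_k (1 - p_k)`, where `p_k` is the
probability of `(0, a)` under the density proportional to `r^{β (k + 1) - 1} e^{-N g(r)}`. -/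
theorem numberVariance_eq_sum {β N : ℕ} (hβ : β = 2 ∨ β = 4) {g : ℝ → ℝ}
    (hg : ContinuousOn g (Ioi 0))
    (hint : ∀ M, β ≤ M + 1 →
      IntegrableOn (fun r => r ^ M * Real.exp (-(N : ℝ) * g r)) (Ioi 0)) {a : ℝ} (ha : 0 < a) :
    numberVariance β N g a = ∑ k ∈ Finset.range N,
      ((∫ r in Ioo 0 a, r ^ (β * (k + 1) - 1) * Real.exp (-(N : ℝ) * g r)) *
        (∫ r in Ici a, r ^ (β * (k + 1) - 1) * Real.exp (-(N : ℝ) * g r))) /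
      (∫ r in Ioi 0, r ^ (β * (k + 1) - 1) * Real.exp (-(N : ℝ) * g r)) ^ 2 := by
  have hgm : Measurable fun z : ℂ => g ‖z‖ := by
    refine measurable_of_continuousOn_compl_singleton 0 ?_
    exact hg.comp continuous_norm.continuousOn fun z hz => norm_pos_iff.2 hz
  obtain ⟨ν, hν, hνB, h⟩ := exists_law_integral_eq hβ hgm (N := N) fun M hM =>
    (integrable_norm_pow_mul_iff M fun r => Real.exp (-(N : ℝ) * g r)).2 (hint (M + 1) (by omega))
  obtain ⟨κ, hκ, hκM⟩ := exists_setIntegral_norm_pow_mul_eq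
  have hB : MeasurableSet {x : ℂ | ‖x‖ < a} := measurableSet_lt measurable_norm measurable_const
  rw [numberVariance_eq_sum_measureReal hν h, ← Fin.sum_univ_eq_sum_range fun k => _ / _]
  refine Finset.sum_congr rfl fun k _ => ?_
  have e1 := hκM (β * (k + 1) - 2) (fun r => Real.exp (-(N : ℝ) * g r)) (Iio a) measurableSet_Iio
  have e2 := hκM (β * (k + 1) - 2) (fun r => Real.exp (-(N : ℝ) * g r)) (Ici a) measurableSet_Ici
  have e3 := hκM (β * (k + 1) - 2) (fun r => Real.exp (-(N : ℝ) * g r)) univ MeasurableSet.univ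
  have s1 : Ioi 0 ∩ Iio a = Ioo 0 a := rfl
  have s2 : Ioi 0 ∩ Ici a = Ici a := inter_eq_right.2 fun x hx => ha.trans_le hx
  have s3 : {z : ℂ | ‖z‖ ∈ Ici a} = {z : ℂ | ‖z‖ < a}ᶜ := by ext z; simp
  have s4 : {z : ℂ | ‖z‖ ∈ (univ : Set ℝ)} = univ := by ext z; simp
  have hM : β * ((k : ℕ) + 1) - 2 + 1 = β * (k + 1) - 1 := by
    have : β ≤ β * (k + 1) := Nat.le_mul_of_pos_right _ (by omega)
    omega
  rw [s1, hM] at e1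
  rw [s2, s3, hM] at e2
  rw [s4, Measure.restrict_univ, inter_univ, hM] at e3
  rw [hνB k _ hB, hνB k _ hB.compl, e2, e3]
  erw [e1]
  rw [mul_div_mul_left _ _ hκ.ne', mul_div_mul_left _ _ hκ.ne']
  ring

/-! ### Tilted convex wells and Riemann sums -/

/-- The variance `p (1 - p)` of the indicator of `v < 0` under the probability density proportional
to `e^{s v - R(v)}`. -/
noncomputable def tiltedVariance (R : ℝ → ℝ) (s : ℝ) : ℝ :=
  (∫ v in Iio 0, Real.exp (s * v - R v)) * (∫ v in Ici 0, Real.exp (s * v - R v)) /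
    (∫ v, Real.exp (s * v - R v)) ^ 2

/-- A continuous convex function on the line with minimal value `0`, attained at the origin. -/
structure IsConvexWell (R : ℝ → ℝ) : Prop where
  convexOn : ConvexOn ℝ univ R
  continuous : Continuous R
  nonneg : ∀ v, 0 ≤ R v
  map_zero : R 0 = 0

namespace IsConvexWell

variable {R : ℝ → ℝ}

lemma comp_neg (hR : IsConvexWell R) : IsConvexWell fun v => R (-v) where
  convexOn := by
    have := hR.convexOn.comp_linearMap (-LinearMap.id)
    simpa [Function.comp_def] using this
  continuous := hR.continuous.comp continuous_neg
  nonneg v := hR.nonneg _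
  map_zero := by simp [hR.map_zero]

lemma mul_apply_le_mul_apply (hR : IsConvexWell R) {L v : ℝ} (hL : 0 < L) (hv : L ≤ v) :
    v * R L ≤ L * R v := by
  have hv0 : 0 < v := hL.trans_le hv
  have h := hR.convexOn.2 (mem_univ 0) (mem_univ v)
    (show 0 ≤ 1 - L / v by rw [sub_nonneg, div_le_one hv0]; exact hv)
    (show 0 ≤ L / v by positivity) (by ring)
  simp only [smul_eq_mul, mul_zero, zero_add, hR.map_zero] at h
  rw [div_mul_cancel₀ _ hv0.ne'] at h
  calc v * R L ≤ v * (L / v * R v) := by gcongr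
    _ = _ := by field_simp

lemma le_of_le (hR : IsConvexWell R) {u v : ℝ} (hu : 0 ≤ u) (hv : u ≤ v) : R u ≤ R v := by
  have h := hR.convexOn.le_max_of_mem_Icc (mem_univ 0) (mem_univ v) (z := u) ⟨hu, hv⟩
  rwa [hR.map_zero, max_eq_right (hR.nonneg v)] at h

lemma setIntegral_Iio_le_one (hR : IsConvexWell R) {s : ℝ} (hs : 1 ≤ s) :
    ∫ v in Iio 0, Real.exp (s * v - R v) ≤ 1 := by
  rw [← integral_exp_Iic_zero, integral_Iic_eq_integral_Iio]
  refine integral_mono_of_nonneg (Eventually.of_forall fun v => (Real.exp_pos _).le)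
    ((integrableOn_exp_Iic 0).mono_set Iio_subset_Iic_self) ?_
  filter_upwards [ae_restrict_mem measurableSet_Iio] with v hv
  have hv : v < 0 := hv
  refine Real.exp_le_exp.2 ?_
  nlinarith [hR.nonneg v]

lemma exp_le_setIntegral_Ici (hR : IsConvexWell R) {s : ℝ} (hs : 1 ≤ s)
    (hint : Integrable fun v => Real.exp (s * v - R v)) :
    Real.exp (s - R 2) ≤ ∫ v in Ici 0, Real.exp (s * v - R v) := by
  calc Real.exp (s - R 2) = ∫ v in Icc (1 : ℝ) 2, Real.exp (s - R 2) := by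
        rw [setIntegral_const]; norm_num
    _ ≤ ∫ v in Icc (1 : ℝ) 2, Real.exp (s * v - R v) := by
        refine setIntegral_mono_on (by simp) hint.integrableOn measurableSet_Icc
          fun v hv => Real.exp_le_exp.2 ?_
        have := hR.le_of_le (by linarith [hv.1]) hv.2
        nlinarith [hv.1]
    _ ≤ _ := setIntegral_mono_set hint.integrableOn
        (Eventually.of_forall fun v => (Real.exp_pos _).le)
        (Eventually.of_forall fun v hv => zero_le_one.trans hv.1)

end IsConvexWell

lemma tiltedVariance_comp_neg (R : ℝ → ℝ) (s : ℝ) :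
    tiltedVariance (fun v => R (-v)) (-s) = tiltedVariance R s := by
  have h1 := integral_comp_neg_Iic 0 fun v => Real.exp (s * v - R v)
  have h2 := integral_comp_neg_Ioi 0 fun v => Real.exp (s * v - R v)
  have h3 := integral_neg_eq_self (fun v => Real.exp (s * v - R v)) volume
  simp only [neg_zero, integral_Iic_eq_integral_Iio, ← integral_Ici_eq_integral_Ioi] at h1 h2
  rw [tiltedVariance, tiltedVariance, ← h1, ← h2, ← h3]
  simp only [mul_neg, neg_mul]
  ring

lemma tiltedVariance_nonneg (R : ℝ → ℝ) (s : ℝ) : 0 ≤ tiltedVariance R s :=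
  div_nonneg (mul_nonneg (integral_nonneg fun _ => (Real.exp_pos _).le)
    (integral_nonneg fun _ => (Real.exp_pos _).le)) (sq_nonneg _)

lemma setIntegral_Iio_add_Ici {f : ℝ → ℝ} (hf : Integrable f) (a : ℝ) :
    (∫ v in Iio a, f v) + ∫ v in Ici a, f v = ∫ v, f v := by
  have := integral_add_compl (measurableSet_Iio (a := a)) hf
  rwa [compl_Iio] at this

lemma tiltedVariance_le_one {R : ℝ → ℝ} {s : ℝ}
    (hint : Integrable fun v => Real.exp (s * v - R v)) : tiltedVariance R s ≤ 1 := by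
  have hA : 0 ≤ ∫ v in Iio 0, Real.exp (s * v - R v) :=
    integral_nonneg fun v => (Real.exp_pos _).le
  have hB : 0 ≤ ∫ v in Ici 0, Real.exp (s * v - R v) :=
    integral_nonneg fun v => (Real.exp_pos _).le
  rw [tiltedVariance, ← setIntegral_Iio_add_Ici hint 0]
  refine div_le_one_of_le₀ ?_ (sq_nonneg _)
  nlinarith [mul_nonneg hA hB, sq_nonneg (∫ v in Iio 0, Real.exp (s * v - R v)),
    sq_nonneg (∫ v in Ici 0, Real.exp (s * v - R v))]

lemma IsConvexWell.tiltedVariance_le_of_one_le {R : ℝ → ℝ} (hR : IsConvexWell R) {s : ℝ}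
    (hs : 1 ≤ s) (hint : Integrable fun v => Real.exp (s * v - R v)) :
    tiltedVariance R s ≤ Real.exp (R 2 - s) := by
  have hA1 := hR.setIntegral_Iio_le_one hs
  have hB1 := hR.exp_le_setIntegral_Ici hs hint
  rw [tiltedVariance, ← setIntegral_Iio_add_Ici hint 0]
  set A := ∫ v in Iio 0, Real.exp (s * v - R v) with hAdef
  set B := ∫ v in Ici 0, Real.exp (s * v - R v)
  have hA : 0 ≤ A := integral_nonneg fun v => (Real.exp_pos _).le
  have hB : 0 < B := (Real.exp_pos _).trans_le hB1
  rw [show R 2 - s = -(s - R 2) by ring, Real.exp_neg]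
  calc A * B / (A + B) ^ 2 ≤ 1 * B / (0 + B) ^ 2 := by gcongr
    _ = B⁻¹ := by field_simp; ring
    _ ≤ _ := by gcongr

lemma IsConvexWell.tiltedVariance_le {R : ℝ → ℝ} (hR : IsConvexWell R) {s K : ℝ}
    (hK : R 2 ≤ K) (hK' : R (-2) ≤ K) (hint : Integrable fun v => Real.exp (s * v - R v)) :
    tiltedVariance R s ≤ Real.exp (1 + K) * Real.exp (-|s|) := by
  rw [← Real.exp_add]
  have hK0 : 0 ≤ K := (hR.nonneg 2).trans hK
  rcases le_or_gt 1 s with h1 | h1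
  · refine (hR.tiltedVariance_le_of_one_le h1 hint).trans (Real.exp_le_exp.2 ?_)
    rw [abs_of_nonneg (by linarith)]
    linarith
  rcases le_or_gt s (-1) with h2 | h2
  · rw [← tiltedVariance_comp_neg]
    have hint' : Integrable fun v => Real.exp (-s * v - R (-v)) := by
      have := hint.comp_neg
      simpa using this
    refine (hR.comp_neg.tiltedVariance_le_of_one_le (by linarith) hint').trans
      (Real.exp_le_exp.2 ?_)
    rw [abs_of_nonpos (by linarith)]
    linarith
  · refine (tiltedVariance_le_one hint).trans (Real.one_le_exp ?_)
    have : |s| ≤ 1 := abs_le.2 ⟨h2.le, h1.le⟩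
    linarith

section Limit

variable {R : ℕ → ℝ → ℝ} {c : ℝ}

/-- By convexity, the growth of the limit `c v² / 2` at one distance `L` forces linear growth of
`R N` beyond it, uniformly in `N`. -/
lemma eventually_exp_le (hc : 0 < c) (hR : ∀ᶠ N in atTop, IsConvexWell (R N))
    (hlim : ∀ v, Tendsto (fun N => R N v) atTop (𝓝 (c * v ^ 2 / 2))) (σ : ℝ) :
    ∃ K, ∀ᶠ N in atTop, ∀ s v, |s| ≤ σ → Real.exp (s * v - R N v) ≤ K * Real.exp (-|v|) := by
  rcases lt_or_ge σ 0 with hσ | hσ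
  · exact ⟨0, Eventually.of_forall fun N s v hs => absurd ((abs_nonneg s).trans hs) hσ.not_ge⟩
  -- At distance `L` the limit `c L² / 2 = (σ + 2) L` exceeds `(σ + 1) L`.
  set L : ℝ := 2 * (σ + 2) / c with hL
  have hL0 : 0 < L := by positivity
  have hval : (σ + 1) * L < c * L ^ 2 / 2 := by
    have : c * L = 2 * (σ + 2) := by rw [hL]; field_simp
    calc (σ + 1) * L < (σ + 2) * L := by gcongr; norm_num
      _ = (c * L) * L / 2 := by rw [this]; ring
      _ = _ := by ring
  have hval' : (σ + 1) * L < c * (-L) ^ 2 / 2 := by rwa [neg_sq]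
  refine ⟨Real.exp ((σ + 1) * L), ?_⟩
  filter_upwards [hR, (hlim L).eventually_const_lt hval, (hlim (-L)).eventually_const_lt hval']
    with N hN h1 h2 s v hs
  rw [← Real.exp_add]
  refine Real.exp_le_exp.2 ?_
  have hsv : s * v ≤ σ * |v| := (le_abs_self _).trans (by rw [abs_mul]; gcongr)
  have hr := hN.nonneg v
  have hbig : L ≤ |v| → (σ + 1) * |v| ≤ R N v := by
    intro hv
    rcases le_total 0 v with h | h
    · rw [abs_of_nonneg h] at hv ⊢
      have := hN.mul_apply_le_mul_apply hL0 hv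
      have h3 : v * ((σ + 1) * L) ≤ v * R N L := by gcongr
      exact le_of_mul_le_mul_left (by linarith) hL0
    · rw [abs_of_nonpos h] at hv ⊢
      have := hN.comp_neg.mul_apply_le_mul_apply hL0 hv
      simp only [neg_neg] at this
      have h3 : (-v) * ((σ + 1) * L) ≤ (-v) * R N (-L) := by gcongr; linarith
      exact le_of_mul_le_mul_left (by linarith) hL0
  rcases le_total L |v| with hv | hv
  · have := hbig hv
    nlinarith [mul_nonneg hσ hL0.le]
  · nlinarith [mul_le_mul_of_nonneg_left hv hσ]

lemma tendsto_setIntegral_exp (hc : 0 < c) (hR : ∀ᶠ N in atTop, IsConvexWell (R N))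
    (hlim : ∀ v, Tendsto (fun N => R N v) atTop (𝓝 (c * v ^ 2 / 2)))
    {s : ℕ → ℝ} {s₀ : ℝ} (hs : Tendsto s atTop (𝓝 s₀)) (B : Set ℝ) :
    Tendsto (fun N => ∫ v in B, Real.exp (s N * v - R N v)) atTop
      (𝓝 (∫ v in B, Real.exp (s₀ * v - c * v ^ 2 / 2))) := by
  obtain ⟨K, hK⟩ := eventually_exp_le hc hR hlim (|s₀| + 1)
  refine tendsto_integral_filter_of_dominated_convergence (fun v => K * Real.exp (-|v|)) ?_ ?_
    (integrable_exp_neg_abs.const_mul K).integrableOn ?_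
  · filter_upwards [hR] with N hN
    have := hN.continuous
    exact (by fun_prop : Continuous fun v => Real.exp (s N * v - R N v)).aestronglyMeasurable
  · filter_upwards [hK, hs.abs.eventually_le_const (lt_add_one _)] with N h1 h2
    refine Eventually.of_forall fun v => ?_
    rw [Real.norm_of_nonneg (Real.exp_pos _).le]
    exact h1 _ _ h2
  · exact Eventually.of_forall fun v =>
      (Real.continuous_exp.tendsto _).comp ((hs.mul_const v).sub (hlim v))

lemma integral_comp_mul_sub (f : ℝ → ℝ) {κ : ℝ} (hκ : 0 < κ) (t : ℝ) :
    ∫ v, f (κ * v - t) = κ⁻¹ * ∫ u, f u := by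
  have h1 := Measure.integral_comp_mul_left (fun u => f (u - t)) κ
  rw [integral_sub_right_eq_self f, abs_of_pos (inv_pos.2 hκ)] at h1
  exact h1

lemma integrable_exp_gaussian (hc : 0 < c) (s : ℝ) :
    Integrable fun v => Real.exp (s * v - c * v ^ 2 / 2) := by
  set κ : ℝ := √(c / 2)
  have hκ2 : κ ^ 2 = c / 2 := Real.sq_sqrt (by positivity)
  have hκ : 0 < κ := by positivity
  have e : ∀ v, Real.exp (s * v - c * v ^ 2 / 2) =
      Real.exp ((s / (2 * κ)) ^ 2) * Real.exp (-(κ * v - s / (2 * κ)) ^ 2) := by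
    intro v
    rw [← Real.exp_add]
    congr 1
    have : (κ * v - s / (2 * κ)) ^ 2 = κ ^ 2 * v ^ 2 - s * v + (s / (2 * κ)) ^ 2 := by
      field_simp; ring
    rw [this, hκ2]; ring
  simp_rw [e]
  exact ((integrable_exp_neg_sq.comp_sub_right _).comp_mul_left' hκ.ne').const_mul _

/-- For the quadratic well the tilted density is Gaussian; completing the square gives
`p = erfc (s / √(2c)) / 2`. -/
lemma tiltedVariance_gaussian (hc : 0 < c) (s : ℝ) :
    tiltedVariance (fun v => c * v ^ 2 / 2) s =
      erfc (s / √(2 * c)) * erfc (-(s / √(2 * c))) / 4 := by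
  set κ : ℝ := √(c / 2) with hκdef
  set t : ℝ := s / √(2 * c) with ht
  have hκ2 : κ ^ 2 = c / 2 := Real.sq_sqrt (by positivity)
  have hκ : 0 < κ := by positivity
  have h2c : √(2 * c) = 2 * κ := by
    rw [hκdef, show 2 * c = 2 ^ 2 * (c / 2) by ring, Real.sqrt_mul (by norm_num),
      Real.sqrt_sq (by norm_num)]
  have e : ∀ v, Real.exp (s * v - c * v ^ 2 / 2) =
      Real.exp (t ^ 2) * Real.exp (-(κ * v - t) ^ 2) := by
    intro v
    rw [← Real.exp_add]
    congr 1
    have : (κ * v - t) ^ 2 = κ ^ 2 * v ^ 2 - s * v + t ^ 2 := by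
      rw [ht, h2c]; field_simp; ring
    rw [this, hκ2]; ring
  have hT : ∫ v, Real.exp (s * v - c * v ^ 2 / 2) = Real.exp (t ^ 2) * (κ⁻¹ * √Real.pi) := by
    simp_rw [e]
    rw [integral_const_mul, integral_comp_mul_sub (fun u => Real.exp (-u ^ 2)) hκ]
    congr 2
    simpa using integral_gaussian 1
  have hA : ∫ v in Iio 0, Real.exp (s * v - c * v ^ 2 / 2) =
      Real.exp (t ^ 2) * (κ⁻¹ * (√Real.pi / 2 * erfc t)) := by
    simp_rw [e]
    rw [integral_const_mul, ← integral_indicator measurableSet_Iio]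
    have e2 : ∀ v, (Iio 0).indicator (fun v => Real.exp (-(κ * v - t) ^ 2)) v =
        (Iio (-t)).indicator (fun u => Real.exp (-u ^ 2)) (κ * v - t) := by
      intro v
      have : v < 0 ↔ κ * v - t < -t := by
        rw [sub_lt_iff_lt_add, neg_add_cancel]
        exact ⟨fun h => mul_neg_of_pos_of_neg hκ h, fun h => by nlinarith⟩
      simp only [indicator_apply, mem_Iio, this]
    simp_rw [e2]
    rw [integral_comp_mul_sub _ hκ, integral_indicator measurableSet_Iio, erfc_eq_integral_Iio]
    have : √Real.pi ≠ 0 := by positivity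
    field_simp
  have hB : ∫ v in Ici 0, Real.exp (s * v - c * v ^ 2 / 2) =
      Real.exp (t ^ 2) * (κ⁻¹ * (√Real.pi / 2 * erfc (-t))) := by
    have h := setIntegral_Iio_add_Ici (integrable_exp_gaussian hc s) 0
    rw [hT, hA] at h
    linear_combination h + (Real.exp (t ^ 2) * κ⁻¹ * √Real.pi / 2) * (-erfc_add_erfc_neg t)
  rw [tiltedVariance, hA, hB, hT]
  have h1 : √Real.pi ≠ 0 := by positivity
  have h2 := (Real.exp_pos (t ^ 2)).ne'
  field_simp
  ring

lemma tendsto_tiltedVariance (hc : 0 < c) (hR : ∀ᶠ N in atTop, IsConvexWell (R N))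
    (hlim : ∀ v, Tendsto (fun N => R N v) atTop (𝓝 (c * v ^ 2 / 2)))
    {s : ℕ → ℝ} {s₀ : ℝ} (hs : Tendsto s atTop (𝓝 s₀)) :
    Tendsto (fun N => tiltedVariance (R N) (s N)) atTop
      (𝓝 (erfc (s₀ / √(2 * c)) * erfc (-(s₀ / √(2 * c))) / 4)) := by
  rw [← tiltedVariance_gaussian hc]
  have hT := tendsto_setIntegral_exp hc hR hlim hs univ
  simp only [Measure.restrict_univ] at hT
  refine ((tendsto_setIntegral_exp hc hR hlim hs _).mul
    (tendsto_setIntegral_exp hc hR hlim hs _)).div (hT.pow 2) (pow_ne_zero 2 ?_)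
  exact (integral_exp_pos (integrable_exp_gaussian hc s₀)).ne'

end Limit

/-- A right-endpoint Riemann sum as the integral of a step function. -/
lemma sum_mul_eq_integral_ceil (N : ℕ) (q : ℝ → ℝ) {δ : ℝ} (hδ : 0 < δ) (m : ℝ) :
    δ * ∑ k ∈ Finset.range N, q (δ * ((k : ℝ) + 1) - m) =
      ∫ s, (Ioc (-m) (δ * N - m)).indicator (fun s => q (δ * ⌈(s + m) / δ⌉ - m)) s := by
  set a : ℕ → ℝ := fun k => δ * k - m with ha
  set h : ℝ → ℝ := fun s => q (δ * ⌈(s + m) / δ⌉ - m) with hh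
  have hmono : Monotone a := fun i j hij => by
    simp only [ha]; gcongr
  have hconst : ∀ k, ∀ s ∈ Ioc (a k) (a (k + 1)), h s = q (δ * ((k : ℝ) + 1) - m) := by
    intro k s hs
    have : ⌈(s + m) / δ⌉ = ((k + 1 : ℕ) : ℤ) := by
      rw [Int.ceil_eq_iff]
      have h1 := hs.1
      have h2 := hs.2
      simp only [ha] at h1 h2
      push_cast at h2 ⊢
      rw [lt_div_iff₀ hδ, div_le_iff₀ hδ]
      constructor <;> nlinarith
    simp only [hh, this]
    push_cast
    rfl
  have hle : ∀ k, a k ≤ a (k + 1) := fun k => hmono (Nat.le_succ k)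
  have hpiece : ∀ k, ∫ s in a k..a (k + 1), h s = δ * q (δ * ((k : ℝ) + 1) - m) := by
    intro k
    rw [intervalIntegral.integral_of_le (hle k),
      setIntegral_congr_fun measurableSet_Ioc (hconst k), ← intervalIntegral.integral_of_le (hle k),
      intervalIntegral.integral_const, smul_eq_mul]
    simp only [ha]
    push_cast
    ring
  have hint : ∀ k < N, IntervalIntegrable h volume (a k) (a (k + 1)) := by
    intro k _
    refine (intervalIntegrable_const (c := q (δ * ((k : ℝ) + 1) - m))).congr ?_
    rw [uIoc_of_le (hle k)]
    exact fun s hs => (hconst k s hs).symm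
  rw [integral_indicator measurableSet_Ioc]
  have h0 : -m = a 0 := by simp [ha]
  have hN : δ * N - m = a N := rfl
  rw [h0, hN, ← intervalIntegral.integral_of_le (hmono (Nat.zero_le N)),
    ← intervalIntegral.sum_integral_adjacent_intervals hint, Finset.mul_sum]
  exact Finset.sum_congr rfl fun k _ => (hpiece k).symm

/-- Riemann sums over the grids `δ_N k - m_N`, `1 ≤ k ≤ N`, of functions `q N` that converge
continuously to `q₀` and are bounded on the grids by `K e^{-|s|}`. -/
lemma tendsto_riemannSum {q : ℕ → ℝ → ℝ} {q₀ : ℝ → ℝ} {δ m : ℕ → ℝ} {I : Set ℝ} {K : ℝ}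
    (hδ : ∀ᶠ N in atTop, 0 < δ N) (hδ0 : Tendsto δ atTop (𝓝 0))
    (hbound : ∀ᶠ N in atTop, ∀ k : ℕ, 1 ≤ k → k ≤ N →
      |q N (δ N * k - m N)| ≤ K * Real.exp (-|δ N * k - m N|))
    (hconv : ∀ s₀, ∀ s : ℕ → ℝ, Tendsto s atTop (𝓝 s₀) →
      Tendsto (fun N => q N (s N)) atTop (𝓝 (q₀ s₀)))
    (hI : MeasurableSet I)
    (hrange : ∀ᵐ s, ∀ᶠ N : ℕ in atTop, (s ∈ Ioc (-m N) (δ N * N - m N) ↔ s ∈ I)) :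
    Tendsto (fun N => δ N * ∑ k ∈ Finset.range N, q N (δ N * ((k : ℝ) + 1) - m N)) atTop
      (𝓝 (∫ s in I, q₀ s)) := by
  set G : ℕ → ℝ → ℝ := fun N =>
    (Ioc (-m N) (δ N * N - m N)).indicator fun s => q N (δ N * ⌈(s + m N) / δ N⌉ - m N) with hG
  have hgrid : ∀ N, 0 < δ N → ∀ s, s ≤ δ N * ⌈(s + m N) / δ N⌉ - m N ∧
      δ N * ⌈(s + m N) / δ N⌉ - m N ≤ s + δ N := by
    intro N hN s
    have h1 := Int.le_ceil ((s + m N) / δ N)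
    have h2 := (Int.ceil_lt_add_one ((s + m N) / δ N)).le
    have h3 : δ N * ((s + m N) / δ N) = s + m N := by field_simp
    constructor
    · nlinarith [mul_le_mul_of_nonneg_left h1 hN.le]
    · nlinarith [mul_le_mul_of_nonneg_left h2 hN.le]
  have key : Tendsto (fun N => ∫ s, G N s) atTop (𝓝 (∫ s, I.indicator q₀ s)) := by
    refine tendsto_integral_filter_of_dominated_convergence
      (fun s => (|K| * Real.exp 1) * Real.exp (-|s|)) ?_ ?_
      (integrable_exp_neg_abs.const_mul _) ?_
    · refine Eventually.of_forall fun N => Measurable.aestronglyMeasurable ?_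
      refine Measurable.indicator ?_ measurableSet_Ioc
      exact (measurable_from_top (f := fun n : ℤ => q N (δ N * n - m N))).comp
        (Int.measurable_ceil.comp (by fun_prop))
    · filter_upwards [hδ, hbound, hδ0.eventually_le_const one_pos] with N h1 h2 h3
      refine Eventually.of_forall fun s => ?_
      by_cases hs : s ∈ Ioc (-m N) (δ N * N - m N)
      · simp only [hG, indicator_of_mem hs, Real.norm_eq_abs]
        obtain ⟨hs1, hs2⟩ := hs
        have c1 : 0 < ⌈(s + m N) / δ N⌉ := Int.ceil_pos.2 (div_pos (by linarith) h1)
        have c2 : ⌈(s + m N) / δ N⌉ ≤ N := Int.ceil_le.2 (by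
          rw [div_le_iff₀ h1]; push_cast; linarith)
        obtain ⟨k, hk⟩ := Int.eq_ofNat_of_zero_le c1.le
        have hb := h2 k (by omega) (by omega)
        have hg := hgrid N h1 s
        rw [hk] at hg ⊢
        simp only [Int.cast_natCast] at hg ⊢
        refine hb.trans ?_
        rw [mul_assoc, ← Real.exp_add]
        have habs : |s| ≤ 1 + |δ N * k - m N| := by
          have : |s - (δ N * k - m N)| ≤ 1 := abs_le.2 ⟨by linarith, by linarith⟩
          linarith [abs_sub_abs_le_abs_sub s (δ N * k - m N)]
        calc K * Real.exp (-|δ N * k - m N|) ≤ |K| * Real.exp (-|δ N * k - m N|) := by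
              gcongr; exact le_abs_self K
          _ ≤ _ := by gcongr; linarith
      · simp only [hG, indicator_of_notMem hs, norm_zero]
        positivity
    · filter_upwards [hrange] with s hs
      have hT : Tendsto (fun N => δ N * ⌈(s + m N) / δ N⌉ - m N) atTop (𝓝 s) := by
        refine tendsto_of_tendsto_of_tendsto_of_le_of_le' (h := fun N => s + δ N)
          tendsto_const_nhds (by simpa using hδ0.const_add s) ?_ ?_
        · filter_upwards [hδ] with N hN using (hgrid N hN s).1
        · filter_upwards [hδ] with N hN using (hgrid N hN s).2
      by_cases hsI : s ∈ I
      · rw [indicator_of_mem hsI]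
        refine (hconv s _ hT).congr' ?_
        filter_upwards [hs] with N hN
        simp only [hG, indicator_of_mem (hN.2 hsI)]
      · rw [indicator_of_notMem hsI]
        refine tendsto_const_nhds.congr' ?_
        filter_upwards [hs] with N hN
        simp only [hG, indicator_of_notMem (fun h => hsI (hN.1 h))]
  rw [integral_indicator hI] at key
  refine key.congr' ?_
  filter_upwards [hδ] with N hN using (sum_mul_eq_integral_ceil N (q N) hN (m N)).symm

lemma tendsto_sum_tiltedVariance {R : ℕ → ℝ → ℝ} {c : ℝ} {δ m : ℕ → ℝ} {I : Set ℝ} (hc : 0 < c)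
    (hR : ∀ᶠ N in atTop, IsConvexWell (R N))
    (hlim : ∀ v, Tendsto (fun N => R N v) atTop (𝓝 (c * v ^ 2 / 2)))
    (hδ : ∀ᶠ N in atTop, 0 < δ N) (hδ0 : Tendsto δ atTop (𝓝 0))
    (hint : ∀ᶠ N in atTop, ∀ k : ℕ, 1 ≤ k → k ≤ N →
      Integrable fun v => Real.exp ((δ N * k - m N) * v - R N v))
    (hI : MeasurableSet I)
    (hrange : ∀ᵐ s, ∀ᶠ N : ℕ in atTop, (s ∈ Ioc (-m N) (δ N * N - m N) ↔ s ∈ I)) :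
    Tendsto (fun N => δ N * ∑ k ∈ Finset.range N,
        tiltedVariance (R N) (δ N * ((k : ℝ) + 1) - m N)) atTop
      (𝓝 (∫ s in I, erfc (s / √(2 * c)) * erfc (-(s / √(2 * c))) / 4)) := by
  refine tendsto_riemannSum (K := Real.exp (1 + (c * 2 ^ 2 / 2 + 1))) hδ hδ0 ?_
    (fun s₀ s hs => tendsto_tiltedVariance hc hR hlim hs) hI hrange
  filter_upwards [hR, hint, (hlim 2).eventually_le_const (lt_add_one _),
    (hlim (-2)).eventually_le_const (lt_add_one _)] with N h1 h2 h3 h4 k hk1 hk2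
  rw [abs_of_nonneg (tiltedVariance_nonneg _ _)]
  rw [neg_sq] at h4
  exact h1.tiltedVariance_le h3 h4 (h2 k hk1 hk2)

/-! ### Logarithmic coordinates -/

/-- The derivative of `u ↦ g (e^u)`, that is, `r g'(r)` at `r = e^u`. -/
noncomputable def logSlope (g : ℝ → ℝ) (u : ℝ) : ℝ := Real.exp u * deriv g (Real.exp u)

/-- The remainder `N (h (b + v / √N) - h b - h' b · v / √N)` of the potential `h u = g (e^u)` in the
logarithmic coordinate, rescaled about `b`. -/
noncomputable def localWell (N : ℕ) (g : ℝ → ℝ) (b v : ℝ) : ℝ :=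
  N * (g (Real.exp (b + v / √N)) - g (Real.exp b) - logSlope g b * (v / √N))

section FixedN

variable {N : ℕ} {g : ℝ → ℝ}

lemma hasDerivAt_comp_exp (hg : DifferentiableOn ℝ g (Ioi 0)) (u : ℝ) :
    HasDerivAt (fun u => g (Real.exp u)) (logSlope g u) u := by
  have h := ((hg.differentiableAt (Ioi_mem_nhds (Real.exp_pos u))).hasDerivAt).comp u
    (Real.hasDerivAt_exp u)
  rwa [mul_comm] at h

lemma monotone_logSlope (hm : MonotoneOn (fun r => r * deriv g r) (Ioi 0)) :
    Monotone (logSlope g) := fun _ _ h =>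
  hm (Real.exp_pos _) (Real.exp_pos _) (Real.exp_le_exp.2 h)

lemma hasDerivAt_localWell (hN : 1 ≤ N) (hg : DifferentiableOn ℝ g (Ioi 0)) (b v : ℝ) :
    HasDerivAt (localWell N g b) (√N * (logSlope g (b + v / √N) - logSlope g b)) v := by
  have hN0 : (0 : ℝ) < N := by exact_mod_cast hN
  have h1 : HasDerivAt (fun v : ℝ => b + v / √N) (1 / √N) v :=
    ((hasDerivAt_id v).div_const _).const_add b
  have h2 := (hasDerivAt_comp_exp hg (b + v / √N)).comp v h1
  have h3 : HasDerivAt (fun v : ℝ => logSlope g b * (v / √N)) (logSlope g b * (1 / √N)) v :=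
    ((hasDerivAt_id v).div_const _).const_mul _
  refine (((h2.sub_const _).sub h3).const_mul (N : ℝ)).congr_deriv ?_
  have hs : √(N : ℝ) ≠ 0 := by positivity
  have : (N : ℝ) = √N * √N := (Real.mul_self_sqrt hN0.le).symm
  rw [this, Real.sqrt_mul_self (Real.sqrt_nonneg _)]
  field_simp

lemma localWell_zero (N : ℕ) (g : ℝ → ℝ) (b : ℝ) : localWell N g b 0 = 0 := by simp [localWell]

lemma isConvexWell_localWell (hN : 1 ≤ N) (hg : DifferentiableOn ℝ g (Ioi 0))
    (hm : MonotoneOn (fun r => r * deriv g r) (Ioi 0)) (b : ℝ) :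
    IsConvexWell (localWell N g b) := by
  have hd := hasDerivAt_localWell hN hg b
  have hderiv : deriv (localWell N g b) = fun v => √N * (logSlope g (b + v / √N) - logSlope g b) :=
    funext fun v => (hd v).deriv
  have hdiff : Differentiable ℝ (localWell N g b) := fun v => (hd v).differentiableAt
  have hconv : ConvexOn ℝ univ (localWell N g b) := by
    refine Monotone.convexOn_univ_of_deriv hdiff ?_
    rw [hderiv]
    intro v w hvw
    have := monotone_logSlope hm (show b + v / √N ≤ b + w / √N by gcongr)
    dsimp only
    gcongr
  have h0 : HasDerivAt (localWell N g b) 0 0 := by simpa using hd 0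
  refine ⟨hconv, hdiff.continuous, fun v => ?_, localWell_zero N g b⟩
  rcases lt_trichotomy v 0 with hv | rfl | hv
  · have := hconv.slope_le_of_hasDerivAt (mem_univ v) (mem_univ 0) hv h0
    rw [slope_def_field, localWell_zero, div_le_iff₀ (by linarith)] at this
    linarith
  · exact (localWell_zero N g b).ge
  · have := hconv.le_slope_of_hasDerivAt (mem_univ 0) (mem_univ v) hv h0
    rw [slope_def_field, localWell_zero, le_div_iff₀ (by linarith)] at this
    linarith

/-- Up to a factor independent of `v`, the substitution `r = e^{b + v / √N}` turns
`r^{K - 1} e^{-N g(r)} dr` into the tilted density of the local well. -/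
lemma weight_comp_exp (hN : 1 ≤ N) (g : ℝ → ℝ) (b : ℝ) {K : ℕ} (hK : 1 ≤ K) (v : ℝ) :
    |Real.exp (b + v / √N) * (1 / √N)| * (Real.exp (b + v / √N) ^ (K - 1) *
        Real.exp (-(N : ℝ) * g (Real.exp (b + v / √N)))) =
      Real.exp (K * b - N * g (Real.exp b)) / √N *
        Real.exp ((K / √N - √N * logSlope g b) * v - localWell N g b v) := by
  have hN0 : (0 : ℝ) < N := by exact_mod_cast hN
  have hs : √(N : ℝ) ≠ 0 := by positivity
  rw [abs_of_pos (by positivity)]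
  have e1 : Real.exp (b + v / √N) * Real.exp (b + v / √N) ^ (K - 1) =
      Real.exp (K * (b + v / √N)) := by
    rw [← pow_succ', Nat.sub_add_cancel hK, Real.exp_nat_mul]
  have e2 : √(N : ℝ) * v = N * (v / √N) := by
    rw [mul_div_assoc', eq_div_iff hs]
    nth_rewrite 3 [← Real.mul_self_sqrt hN0.le]
    ring
  calc _ = (Real.exp (b + v / √N) * Real.exp (b + v / √N) ^ (K - 1)) *
        Real.exp (-(N : ℝ) * g (Real.exp (b + v / √N))) / √N := by ring
    _ = Real.exp (K * (b + v / √N) + -(N : ℝ) * g (Real.exp (b + v / √N))) / √N := by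
        rw [e1, ← Real.exp_add]
    _ = _ := by
        rw [div_mul_eq_mul_div, ← Real.exp_add]
        congr 2
        rw [localWell]
        linear_combination (logSlope g b) * e2

lemma hasDerivAt_exp_affine (N : ℕ) (b v : ℝ) :
    HasDerivAt (fun v : ℝ => Real.exp (b + v / √N)) (Real.exp (b + v / √N) * (1 / √N)) v :=
  (((hasDerivAt_id v).div_const _).const_add b).exp

lemma injective_exp_affine (hN : 1 ≤ N) (b : ℝ) :
    Function.Injective fun v : ℝ => Real.exp (b + v / √N) := by
  have hN0 : (0 : ℝ) < N := by exact_mod_cast hN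
  intro v w h
  have := Real.exp_injective h
  have hs : √(N : ℝ) ≠ 0 := by positivity
  field_simp at this
  linarith

lemma setIntegral_weight_image (hN : 1 ≤ N) (g : ℝ → ℝ) (b : ℝ) {K : ℕ} (hK : 1 ≤ K)
    {s : Set ℝ} (hs : MeasurableSet s) :
    ∫ r in (fun v : ℝ => Real.exp (b + v / √N)) '' s, r ^ (K - 1) * Real.exp (-(N : ℝ) * g r) =
      Real.exp (K * b - N * g (Real.exp b)) / √N *
        ∫ v in s, Real.exp ((K / √N - √N * logSlope g b) * v - localWell N g b v) := by
  rw [integral_image_eq_integral_abs_deriv_smul hs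
    (fun v _ => (hasDerivAt_exp_affine N b v).hasDerivWithinAt)
    (injective_exp_affine hN b).injOn]
  simp_rw [smul_eq_mul, weight_comp_exp hN g b hK]
  rw [integral_const_mul]

lemma exp_affine_lt_iff (hN : 1 ≤ N) (b v : ℝ) : Real.exp (b + v / √N) < Real.exp b ↔ v < 0 := by
  have hN0 : (0 : ℝ) < N := by exact_mod_cast hN
  have hs : 0 < √(N : ℝ) := by positivity
  rw [Real.exp_lt_exp, add_lt_iff_neg_left, div_lt_iff₀ hs, zero_mul]

lemma exists_exp_affine_eq (hN : 1 ≤ N) (b : ℝ) {r : ℝ} (hr : 0 < r) :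
    ∃ v : ℝ, Real.exp (b + v / √N) = r := by
  have hN0 : (0 : ℝ) < N := by exact_mod_cast hN
  have hs : √(N : ℝ) ≠ 0 := by positivity
  refine ⟨(Real.log r - b) * √N, ?_⟩
  rw [mul_div_cancel_right₀ _ hs, add_sub_cancel, Real.exp_log hr]

lemma image_exp_affine_univ (hN : 1 ≤ N) (b : ℝ) :
    (fun v : ℝ => Real.exp (b + v / √N)) '' univ = Ioi 0 := by
  ext r
  constructor
  · rintro ⟨v, -, rfl⟩
    exact Real.exp_pos _
  · intro hr
    obtain ⟨v, hv⟩ := exists_exp_affine_eq hN b hr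
    exact ⟨v, mem_univ v, hv⟩

lemma image_exp_affine_Iio (hN : 1 ≤ N) (b : ℝ) :
    (fun v : ℝ => Real.exp (b + v / √N)) '' Iio 0 = Ioo 0 (Real.exp b) := by
  ext r
  constructor
  · rintro ⟨v, hv, rfl⟩
    exact ⟨Real.exp_pos _, (exp_affine_lt_iff hN b v).2 hv⟩
  · rintro ⟨hr, hrb⟩
    obtain ⟨v, rfl⟩ := exists_exp_affine_eq hN b hr
    exact ⟨v, (exp_affine_lt_iff hN b v).1 hrb, rfl⟩

lemma image_exp_affine_Ici (hN : 1 ≤ N) (b : ℝ) :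
    (fun v : ℝ => Real.exp (b + v / √N)) '' Ici 0 = Ici (Real.exp b) := by
  ext r
  constructor
  · rintro ⟨v, hv, rfl⟩
    exact not_lt.1 fun h => not_lt.2 hv ((exp_affine_lt_iff hN b v).1 h)
  · intro hrb
    obtain ⟨v, rfl⟩ := exists_exp_affine_eq hN b ((Real.exp_pos b).trans_le hrb)
    exact ⟨v, not_lt.1 fun h => not_lt.2 hrb ((exp_affine_lt_iff hN b v).2 h), rfl⟩

lemma integrable_exp_localWell (hN : 1 ≤ N) (b : ℝ) {K : ℕ} (hK : 1 ≤ K)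
    (hint : IntegrableOn (fun r => r ^ (K - 1) * Real.exp (-(N : ℝ) * g r)) (Ioi 0)) :
    Integrable fun v => Real.exp ((K / √N - √N * logSlope g b) * v - localWell N g b v) := by
  have hN0 : (0 : ℝ) < N := by exact_mod_cast hN
  rw [← image_exp_affine_univ hN b, integrableOn_image_iff_integrableOn_abs_deriv_smul
    MeasurableSet.univ (fun v _ => (hasDerivAt_exp_affine N b v).hasDerivWithinAt)
    (injective_exp_affine hN b).injOn, integrableOn_univ] at hint
  simp_rw [smul_eq_mul, weight_comp_exp hN g b hK] at hint
  rwa [integrable_const_mul_iff (IsUnit.mk0 _ (by positivity))] at hint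

lemma numberVariance_exp_eq_sum {β : ℕ} (hβ : β = 2 ∨ β = 4) (hN : 1 ≤ N)
    (hg : DifferentiableOn ℝ g (Ioi 0))
    (hint : ∀ M, β ≤ M + 1 →
      IntegrableOn (fun r => r ^ M * Real.exp (-(N : ℝ) * g r)) (Ioi 0)) (b : ℝ) :
    numberVariance β N g (Real.exp b) = ∑ k ∈ Finset.range N,
      tiltedVariance (localWell N g b) (β / √N * ((k : ℝ) + 1) - √N * logSlope g b) := by
  have hN0 : (0 : ℝ) < N := by exact_mod_cast hN
  rw [numberVariance_eq_sum hβ hg.continuousOn hint (Real.exp_pos b)]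
  refine Finset.sum_congr rfl fun k _ => ?_
  have hK : 1 ≤ β * (k + 1) := by
    have : 0 < β := by omega
    exact Nat.mul_pos this k.succ_pos
  have h1 := setIntegral_weight_image hN g b hK (measurableSet_Iio (a := (0 : ℝ)))
  have h2 := setIntegral_weight_image hN g b hK (measurableSet_Ici (a := (0 : ℝ)))
  have h3 := setIntegral_weight_image hN g b hK MeasurableSet.univ
  rw [image_exp_affine_Iio hN] at h1
  rw [image_exp_affine_Ici hN] at h2
  rw [image_exp_affine_univ hN, Measure.restrict_univ] at h3
  have es : β / √(N : ℝ) * ((k : ℝ) + 1) = ((β * (k + 1) : ℕ) : ℝ) / √N := by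
    push_cast; ring
  rw [h1, h2, h3, tiltedVariance, es]
  have hC : Real.exp (((β * (k + 1) : ℕ) : ℝ) * b - N * g (Real.exp b)) / √N ≠ 0 := by positivity
  generalize Real.exp (((β * (k + 1) : ℕ) : ℝ) * b - N * g (Real.exp b)) / √N = C at hC
  rw [mul_mul_mul_comm, mul_pow, ← sq, mul_div_mul_left _ _ (pow_ne_zero 2 hC)]

end FixedN

lemma IsSuitable.integrableOn {β : ℕ} {gN : ℕ → ℝ → ℝ} {g : ℝ → ℝ} (hQ : IsSuitable β gN g)
    {N : ℕ} (hN : 1 ≤ N) {M : ℕ} (hM : β ≤ M + 1) :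
    IntegrableOn (fun r => r ^ M * Real.exp (-(N : ℝ) * gN N r)) (Ioi 0) := by
  have hN1 : (1 : ℝ) ≤ N := by exact_mod_cast hN
  have hcont : ContinuousOn (fun r => r ^ M * Real.exp (-(N : ℝ) * gN N r)) (Ioi 0) := by
    have := (hQ.differentiableOn N hN).continuousOn
    fun_prop
  rw [← Ioc_union_Ioi_eq_Ioi zero_le_one]
  refine IntegrableOn.union ?_ (IntegrableOn.mono_set ?_ Ioi_subset_Ici_self)
  · refine (hQ.integrable_zero N hN).mono'
      ((hcont.mono Ioc_subset_Ioi_self).aestronglyMeasurable measurableSet_Ioc) ?_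
    filter_upwards [ae_restrict_mem measurableSet_Ioc] with r hr
    rw [Real.norm_of_nonneg (mul_nonneg (pow_nonneg hr.1.le _) (Real.exp_pos _).le)]
    gcongr ?_ * _
    exact pow_le_pow_of_le_one hr.1.le hr.2 (by omega)
  · refine LocallyIntegrableOn.integrableOn_of_isBigO_atTop (g := fun r : ℝ => r ^ (-2 : ℝ))
      ((hcont.mono (Ici_subset_Ioi.2 one_pos)).locallyIntegrableOn measurableSet_Ici)
      (Asymptotics.IsBigO.of_bound 1 ?_)
      ⟨Ioi 1, Ioi_mem_atTop 1, integrableOn_Ioi_rpow_of_lt (by norm_num) one_pos⟩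
    filter_upwards [(hQ.growth N hN).eventually_ge_atTop ((M : ℝ) + 2), eventually_gt_atTop 1]
      with r hr hr1
    have hr0 : 0 < r := by linarith
    have hlog : 0 < Real.log r := Real.log_pos hr1
    rw [le_div_iff₀ hlog] at hr
    rw [Real.norm_of_nonneg (by positivity), Real.norm_of_nonneg (by positivity), one_mul,
      ← Real.rpow_natCast, Real.rpow_def_of_pos hr0, Real.rpow_def_of_pos hr0, ← Real.exp_add]
    refine Real.exp_le_exp.2 ?_
    nlinarith [mul_nonneg (Nat.cast_nonneg (α := ℝ) M) hlog.le]

section Asymptotics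

variable {gN : ℕ → ℝ → ℝ} {b₀ c : ℝ}

/-- If the derivatives of the functions `logSlope (gN N)` converge to `c` jointly in `N` and the
point, then these functions are, near `b₀` and for large `N`, affine of slope `c` up to a small
relative error. -/
lemma eventually_abs_logSlope_sub_le {D : ℕ → ℝ → ℝ}
    (hD : ∀ᶠ p : ℕ × ℝ in atTop ×ˢ 𝓝 b₀, HasDerivAt (logSlope (gN p.1)) (D p.1 p.2) p.2)
    (hDc : Tendsto (fun p : ℕ × ℝ => D p.1 p.2) (atTop ×ˢ 𝓝 b₀) (𝓝 c)) {ε : ℝ} (hε : 0 < ε) :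
    ∃ η > 0, ∀ᶠ N in atTop, ∀ x ∈ Metric.ball b₀ η, ∀ y ∈ Metric.ball b₀ η,
      |logSlope (gN N) y - logSlope (gN N) x - c * (y - x)| ≤ ε * |y - x| := by
  have h := hD.and (hDc.eventually (Metric.closedBall_mem_nhds c hε))
  obtain ⟨pa, ha, pb, hb, hab⟩ := eventually_prod_iff.1 h
  obtain ⟨η, hη, hball⟩ := Metric.eventually_nhds_iff_ball.1 hb
  refine ⟨η, hη, ?_⟩
  filter_upwards [ha] with N hN x hx y hy
  have h1 : ∀ u ∈ Metric.ball b₀ η, HasDerivWithinAt (fun u => logSlope (gN N) u - c * u)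
      (D N u - c) (Metric.ball b₀ η) u := by
    intro u hu
    have := ((hab hN (hball u hu)).1.sub ((hasDerivAt_id u).const_mul c)).hasDerivWithinAt
      (s := Metric.ball b₀ η)
    rw [mul_one] at this
    exact this
  have h2 : ∀ u ∈ Metric.ball b₀ η, ‖D N u - c‖ ≤ ε := fun u hu => (hab hN (hball u hu)).2
  have := (convex_ball b₀ η).norm_image_sub_le_of_norm_hasDerivWithin_le h1 h2 hx hy
  rw [Real.norm_eq_abs, Real.norm_eq_abs] at this
  convert this using 2
  ring

lemma tendsto_sqrt_natCast_atTop : Tendsto (fun N : ℕ => √(N : ℝ)) atTop atTop :=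
  Real.tendsto_sqrt_atTop.comp tendsto_natCast_atTop_atTop

lemma tendsto_localWell (hg : ∀ N, 1 ≤ N → DifferentiableOn ℝ (gN N) (Ioi 0))
    (hlin : ∀ ε > 0, ∃ η > 0, ∀ᶠ N in atTop, ∀ x ∈ Metric.ball b₀ η, ∀ y ∈ Metric.ball b₀ η,
      |logSlope (gN N) y - logSlope (gN N) x - c * (y - x)| ≤ ε * |y - x|)
    {b : ℕ → ℝ} (hb : Tendsto b atTop (𝓝 b₀)) (v : ℝ) :
    Tendsto (fun N => localWell N (gN N) (b N) v) atTop (𝓝 (c * v ^ 2 / 2)) := by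
  rw [Metric.tendsto_nhds]
  intro ε hε
  have hε' : 0 < ε / (|v| ^ 2 + 1) := by positivity
  obtain ⟨η, hη, hN⟩ := hlin _ hε'
  have hsmall : Tendsto (fun N : ℕ => |v| / √(N : ℝ)) atTop (𝓝 0) :=
    tendsto_sqrt_natCast_atTop.const_div_atTop _
  filter_upwards [hN, eventually_ge_atTop 1, hb.eventually (Metric.ball_mem_nhds b₀ (half_pos hη)),
    hsmall.eventually_lt_const (half_pos hη)] with N h1 hN1 h2 h3
  have hN0 : (0 : ℝ) < N := by exact_mod_cast hN1
  have hs : 0 < √(N : ℝ) := by positivity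
  have hbη : b N ∈ Metric.ball b₀ η := Metric.ball_subset_ball (by linarith) h2
  -- The mean value inequality for the difference with the limit on the segment from `0` to `v`.
  have hder : ∀ w ∈ uIcc 0 v, HasDerivWithinAt (fun w => localWell N (gN N) (b N) w - c * w ^ 2 / 2)
      (√N * (logSlope (gN N) (b N + w / √N) - logSlope (gN N) (b N)) - c * w) (uIcc 0 v) w := by
    intro w _
    have e : HasDerivAt (fun w : ℝ => c * w ^ 2 / 2) (c * w) w := by
      refine (((hasDerivAt_pow 2 w).const_mul c).div_const 2).congr_deriv ?_
      simp; ring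
    exact ((hasDerivAt_localWell hN1 (hg N hN1) (b N) w).sub e).hasDerivWithinAt
  have hbd : ∀ w ∈ uIcc 0 v,
      ‖√N * (logSlope (gN N) (b N + w / √N) - logSlope (gN N) (b N)) - c * w‖ ≤
        ε / (|v| ^ 2 + 1) * |v| := by
    intro w hw
    have hwv : |w| ≤ |v| := by
      have := abs_sub_left_of_mem_uIcc hw
      simpa using this
    have hx : b N + w / √N ∈ Metric.ball b₀ η := by
      rw [Real.dist_eq] at h2
      rw [Metric.mem_ball, Real.dist_eq]
      have : |w / √(N : ℝ)| ≤ |v| / √N := by rw [abs_div, abs_of_pos hs]; gcongr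
      calc |b N + w / √N - b₀| = |(b N - b₀) + w / √N| := by ring_nf
        _ ≤ |b N - b₀| + |w / √N| := abs_add_le _ _
        _ < η := by linarith
    have := h1 _ hbη _ hx
    rw [add_sub_cancel_left, abs_div, abs_of_pos hs] at this
    have e : √(N : ℝ) * (logSlope (gN N) (b N + w / √N) - logSlope (gN N) (b N)) - c * w =
        √N * (logSlope (gN N) (b N + w / √N) - logSlope (gN N) (b N) - c * (w / √N)) := by
      field_simp
    rw [Real.norm_eq_abs, e, abs_mul, abs_of_pos hs]
    calc _ ≤ √N * (ε / (|v| ^ 2 + 1) * (|w| / √N)) := by gcongr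
      _ = ε / (|v| ^ 2 + 1) * |w| := by field_simp
      _ ≤ _ := by gcongr
  have := (convex_uIcc 0 v).norm_image_sub_le_of_norm_hasDerivWithin_le hder hbd
    left_mem_uIcc right_mem_uIcc
  simp only [localWell_zero, sub_zero, Real.norm_eq_abs] at this
  rw [Real.dist_eq]
  have e0 : c * (0 : ℝ) ^ 2 / 2 = 0 := by simp
  rw [e0, sub_zero, sub_zero] at this
  refine this.trans_lt ?_
  rw [mul_assoc, ← sq, div_mul_eq_mul_div, div_lt_iff₀ (by positivity)]
  nlinarith

/-- The limit of the number variance of the disc of radius `e^{b_N}`. The set `I` is the limiting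
range of the slopes of the tilted densities. -/
lemma tendsto_numberVariance {β : ℕ} (hβ : β = 2 ∨ β = 4) {g : ℝ → ℝ} (hQ : IsSuitable β gN g)
    (hc : 0 < c)
    (hlin : ∀ ε > 0, ∃ η > 0, ∀ᶠ N in atTop, ∀ x ∈ Metric.ball b₀ η, ∀ y ∈ Metric.ball b₀ η,
      |logSlope (gN N) y - logSlope (gN N) x - c * (y - x)| ≤ ε * |y - x|)
    {b : ℕ → ℝ} (hb : Tendsto b atTop (𝓝 b₀)) {I : Set ℝ} (hI : MeasurableSet I)
    (hlow : Tendsto (fun N : ℕ => √N * logSlope (gN N) (b N)) atTop atTop)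
    (hup : ∀ᵐ s, ∀ᶠ N : ℕ in atTop, (s ≤ √N * (β - logSlope (gN N) (b N)) ↔ s ∈ I)) :
    Tendsto (fun N : ℕ => β / √N * numberVariance β N (gN N) (Real.exp (b N))) atTop
      (𝓝 (∫ s in I, erfc (s / √(2 * c)) * erfc (-(s / √(2 * c))) / 4)) := by
  have hβ0 : 0 < β := by omega
  have hβ0' : (0 : ℝ) < β := by exact_mod_cast hβ0
  have h := tendsto_sum_tiltedVariance (R := fun N => localWell N (gN N) (b N)) (c := c)
    (δ := fun N => β / √N) (m := fun N => √N * logSlope (gN N) (b N)) (I := I) hc ?_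
    (fun v => tendsto_localWell hQ.differentiableOn hlin hb v) ?_ ?_ ?_ hI ?_
  · refine h.congr' ?_
    filter_upwards [eventually_ge_atTop 1] with N hN
    rw [numberVariance_exp_eq_sum hβ hN (hQ.differentiableOn N hN)
      (fun M hM => hQ.integrableOn hN hM)]
  · filter_upwards [eventually_ge_atTop 1] with N hN
    exact isConvexWell_localWell hN (hQ.differentiableOn N hN) (hQ.monotoneOn N hN) _
  · filter_upwards [eventually_ge_atTop 1] with N hN
    have hN0 : (0 : ℝ) < N := by exact_mod_cast hN
    positivity
  · exact tendsto_sqrt_natCast_atTop.const_div_atTop _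
  · filter_upwards [eventually_ge_atTop 1] with N hN k hk _
    have hK : β ≤ β * k := Nat.le_mul_of_pos_right _ hk
    have := integrable_exp_localWell hN (b N) (K := β * k) (by omega)
      (hQ.integrableOn hN (M := β * k - 1) (by omega))
    push_cast at this
    rwa [show (β : ℝ) * k / √N = β / √N * k by ring] at this
  · filter_upwards [hup] with s hs
    filter_upwards [hs, hlow.eventually_gt_atTop (-s), eventually_ge_atTop 1] with N h1 h2 hN
    have hN0 : (0 : ℝ) < N := by exact_mod_cast hN
    have e : (β : ℝ) / √N * N - √N * logSlope (gN N) (b N) =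
        √N * (β - logSlope (gN N) (b N)) := by
      have h3 : √(N : ℝ) ≠ 0 := by positivity
      have h4 : √(N : ℝ) * √N = N := Real.mul_self_sqrt hN0.le
      field_simp
      linear_combination (-(β : ℝ)) * h4
    rw [e, mem_Ioc, h1]
    exact ⟨fun h => h.2, fun h => ⟨by linarith, h⟩⟩

end Asymptotics

/-! ### Bulk and edge asymptotics -/

lemma iteratedDerivWithin_of_mem_nhds (k : ℕ) (f : ℝ → ℝ) {s : Set ℝ} {x : ℝ} (hs : s ∈ 𝓝 x) :
    iteratedDerivWithin k f s x = iteratedDeriv k f x := by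
  have h : s =ᶠ[𝓝 x] univ := eventuallyEq_univ.2 hs
  rw [← iteratedDerivWithin_univ, iteratedDerivWithin, iteratedDerivWithin,
    iteratedFDerivWithin_congr_set h]

lemma C2Converges.tendsto_iteratedDeriv {gN : ℕ → ℝ → ℝ} {g : ℝ → ℝ} {s : Set ℝ}
    (h : C2Converges gN g s) (hg : ContDiffOn ℝ 2 g s) (hu : UniqueDiffOn ℝ s) {a : ℝ}
    (hs : s ∈ 𝓝 a) {k : ℕ} (hk : k ≤ 2) :
    Tendsto (fun p : ℕ × ℝ => iteratedDeriv k (gN p.1) p.2) (atTop ×ˢ 𝓝 a)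
      (𝓝 (iteratedDeriv k g a)) := by
  have h1 := tendstoLocallyUniformlyOn_iff_forall_tendsto.1 (h k hk) a (mem_of_mem_nhds hs)
  rw [nhdsWithin_eq_nhds.2 hs] at h1
  have h2 : ContinuousAt (iteratedDerivWithin k g s) a :=
    (hg.continuousOn_iteratedDerivWithin (by exact_mod_cast hk) hu).continuousAt hs
  have h3 : Tendsto (fun p : ℕ × ℝ => iteratedDerivWithin k (gN p.1) s p.2) (atTop ×ˢ 𝓝 a)
      (𝓝 (iteratedDerivWithin k g s a)) :=
    (tendsto_iff_of_dist (tendsto_uniformity_iff_dist_tendsto_zero.1 h1)).1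
      (h2.tendsto.comp tendsto_snd)
  rw [iteratedDerivWithin_of_mem_nhds k g hs] at h3
  refine h3.congr' ?_
  filter_upwards [tendsto_snd.eventually (eventually_mem_nhds_iff.2 hs)] with p hp
  exact iteratedDerivWithin_of_mem_nhds k _ hp

lemma hasDerivAt_deriv_of_contDiffAt {f : ℝ → ℝ} {x : ℝ} (hf : ContDiffAt ℝ 2 f x) :
    HasDerivAt (deriv f) (deriv (deriv f) x) x :=
  ((hf.derivWithin (m := 1) (by norm_num)).differentiableAt (by norm_num)).hasDerivAt

lemma hasDerivAt_logSlope {f : ℝ → ℝ} {u : ℝ} (hf : ContDiffAt ℝ 2 f (Real.exp u)) :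
    HasDerivAt (logSlope f) (Real.exp u * deriv f (Real.exp u) +
      Real.exp u * (deriv (deriv f) (Real.exp u) * Real.exp u)) u :=
  (Real.hasDerivAt_exp u).mul ((hasDerivAt_deriv_of_contDiffAt hf).comp u (Real.hasDerivAt_exp u))

/-- The slope is the derivative `4 r² ΔQ(r)` of `u ↦ e^u g'(e^u)`, with `r = e^b`. -/
lemma C2Converges.eventually_abs_logSlope_sub_le {gN : ℕ → ℝ → ℝ} {g : ℝ → ℝ} {s : Set ℝ}
    (h : C2Converges gN g s) (hgN : ∀ N, 1 ≤ N → ContDiffOn ℝ 2 (gN N) s)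
    (hg : ContDiffOn ℝ 2 g s) (hu : UniqueDiffOn ℝ s) {b : ℝ} (hs : s ∈ 𝓝 (Real.exp b))
    {ε : ℝ} (hε : 0 < ε) :
    ∃ η > 0, ∀ᶠ N in atTop, ∀ x ∈ Metric.ball b η, ∀ y ∈ Metric.ball b η,
      |logSlope (gN N) y - logSlope (gN N) x -
        4 * Real.exp b ^ 2 * radialLaplacian g (Real.exp b) * (y - x)| ≤ ε * |y - x| := by
  have hmap : Tendsto (fun p : ℕ × ℝ => (p.1, Real.exp p.2)) (atTop ×ˢ 𝓝 b)
      (atTop ×ˢ 𝓝 (Real.exp b)) :=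
    tendsto_fst.prodMk ((Real.continuous_exp.tendsto b).comp tendsto_snd)
  have hexp : Tendsto (fun p : ℕ × ℝ => Real.exp p.2) (atTop ×ˢ 𝓝 b) (𝓝 (Real.exp b)) :=
    (Real.continuous_exp.tendsto b).comp tendsto_snd
  have h1 := (h.tendsto_iteratedDeriv hg hu hs (k := 1) (by norm_num)).comp hmap
  have h2 := (h.tendsto_iteratedDeriv hg hu hs (k := 2) le_rfl).comp hmap
  simp only [Function.comp_def, iteratedDeriv_succ, iteratedDeriv_zero] at h1 h2
  refine _root_.CoulombGas.eventually_abs_logSlope_sub_le 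
    (D := fun N u => Real.exp u * deriv (gN N) (Real.exp u) +
      Real.exp u * (deriv (deriv (gN N)) (Real.exp u) * Real.exp u)) ?_ ?_ hε
  · filter_upwards [tendsto_fst.eventually (eventually_ge_atTop 1),
      hexp.eventually (eventually_mem_nhds_iff.2 hs)] with p hp1 hp2
    exact hasDerivAt_logSlope ((hgN _ hp1).contDiffAt hp2)
  · have := (hexp.mul h1).add (hexp.mul (h2.mul hexp))
    convert this using 2
    rw [radialLaplacian]
    have := (Real.exp_pos b).ne'
    field_simp
    ring

section Potential

variable {β : ℕ} {gN : ℕ → ℝ → ℝ} {g : ℝ → ℝ}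

lemma IsSuitable.strictMonoOn (hQ : IsSuitable β gN g) :
    StrictMonoOn (fun r => r * deriv g r) (Ioo 0 1) := by
  have hc : ContDiffOn ℝ 2 g (Ioo 0 1) := hQ.contDiffOn_lim.mono Ioo_subset_Ioc_self
  have hd : ∀ r ∈ Ioo (0 : ℝ) 1, HasDerivAt (fun r => r * deriv g r)
      (1 * deriv g r + r * deriv (deriv g) r) r := fun r hr =>
    (hasDerivAt_id r).mul (hasDerivAt_deriv_of_contDiffAt (hc.contDiffAt (isOpen_Ioo.mem_nhds hr)))
  refine strictMonoOn_of_deriv_pos (convex_Ioo 0 1)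
    (fun r hr => (hd r hr).continuousAt.continuousWithinAt) fun r hr => ?_
  rw [interior_Ioo] at hr
  rw [(hd r hr).deriv]
  have h := hQ.laplacian_pos r hr
  have hr0 := hr.1
  have e : 1 * deriv g r + r * deriv (deriv g) r = 4 * r * radialLaplacian g r := by
    rw [radialLaplacian]; field_simp; ring
  rw [e]
  positivity

lemma IsSuitable.mul_deriv_pos (hQ : IsSuitable β gN g) {a : ℝ} (ha : a ∈ Ioo (0 : ℝ) 1) :
    0 < a * deriv g a := by
  have hmem : a / 2 ∈ Ioo (0 : ℝ) 1 := ⟨by linarith [ha.1], by linarith [ha.1, ha.2]⟩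
  have h1 := hQ.strictMonoOn hmem ha (by linarith [ha.1])
  refine lt_of_le_of_lt (le_of_tendsto hQ.tendsto_zero ?_) h1
  filter_upwards [Ioo_mem_nhdsGT hmem.1] with r hr
  exact (hQ.strictMonoOn ⟨hr.1, hr.2.trans hmem.2⟩ hmem hr.2).le

lemma IsSuitable.mul_deriv_lt (hQ : IsSuitable β gN g) {a : ℝ} (ha : a ∈ Ioo (0 : ℝ) 1) :
    a * deriv g a < β := by
  have hmem : (a + 1) / 2 ∈ Ioo (0 : ℝ) 1 := ⟨by linarith [ha.1], by linarith [ha.2]⟩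
  have h1 := hQ.strictMonoOn ha hmem (by linarith [ha.2])
  refine h1.trans_le ?_
  have hu := uniqueDiffOn_Ioc (0 : ℝ) 1
  have hmem1 : (1 : ℝ) ∈ Ioc (0 : ℝ) 1 := ⟨one_pos, le_rfl⟩
  have hcont := (hQ.contDiffOn_lim.continuousOn_derivWithin hu (by norm_num)) 1 hmem1
  have hd1 : derivWithin g (Ioc 0 1) 1 = β := hQ.deriv_one.derivWithin (hu 1 hmem1)
  have hlim : Tendsto (fun r => r * deriv g r) (𝓝[<] 1) (𝓝 (1 * β)) := by
    have hle : 𝓝[<] (1 : ℝ) ≤ 𝓝[Ioc 0 1] 1 :=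
      le_inf inf_le_left (le_principal_iff.2 (mem_of_superset (Ioo_mem_nhdsLT one_pos)
        Ioo_subset_Ioc_self))
    have h2 : Tendsto (derivWithin g (Ioc 0 1)) (𝓝[<] 1) (𝓝 (β : ℝ)) := by
      rw [← hd1]; exact hcont.mono_left hle
    refine (tendsto_nhdsWithin_of_tendsto_nhds tendsto_id).mul (h2.congr' ?_)
    filter_upwards [Ioo_mem_nhdsLT one_pos] with r hr
    exact derivWithin_of_mem_nhds (Ioc_mem_nhds hr.1 hr.2)
  rw [one_mul] at hlim
  refine ge_of_tendsto hlim ?_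
  filter_upwards [Ioo_mem_nhdsLT hmem.2] with r hr
  exact (hQ.strictMonoOn hmem ⟨hmem.1.trans hr.1, hr.2⟩ hr.1).le

lemma integral_erfc_div {κ : ℝ} (hκ : 0 < κ) :
    ∫ s, erfc (s / κ) * erfc (-(s / κ)) / 4 = κ / √(2 * Real.pi) := by
  have h := Measure.integral_comp_div (fun t => erfc t * erfc (-t) / 4) κ
  rw [h, abs_of_pos hκ, smul_eq_mul]
  have := integral_erfc_mul_erfc_neg
  have h2 : √(2 * Real.pi) ≠ 0 := by positivity
  field_simp
  linear_combination this

lemma setIntegral_Iic_erfc_div {κ : ℝ} (hκ : 0 < κ) (S : ℝ) :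
    ∫ s in Iic (κ * S), erfc (s / κ) * erfc (-(s / κ)) / 4 =
      κ / √(2 * Real.pi) * edgeFunction S := by
  have h := Measure.integral_comp_div
    ((Iic S).indicator fun t => erfc t * erfc (-t) / 4) κ
  rw [abs_of_pos hκ, smul_eq_mul, integral_indicator measurableSet_Iic] at h
  have e : ∀ s, (Iic (κ * S)).indicator (fun s => erfc (s / κ) * erfc (-(s / κ)) / 4) s =
      (Iic S).indicator (fun t => erfc t * erfc (-t) / 4) (s / κ) := by
    intro s
    simp only [indicator_apply, mem_Iic, div_le_iff₀ hκ, mul_comm κ S]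
  rw [← integral_indicator measurableSet_Iic]
  simp_rw [e]
  rw [h, edgeFunction]
  have h2 : √(2 * Real.pi) ≠ 0 := by positivity
  field_simp

theorem tendsto_numberVariance_bulk (hβ : β = 2 ∨ β = 4) (hQ : IsSuitable β gN g) {a : ℝ}
    (ha : a ∈ Ioo (0 : ℝ) 1) :
    Tendsto (fun N : ℕ => (β : ℝ) / √((N : ℝ) * radialLaplacian g a) *
      numberVariance β N (gN N) a) atTop (𝓝 (2 * a / √Real.pi)) := by
  have ha0 := ha.1
  have hΔ := hQ.laplacian_pos a ha
  set Δ := radialLaplacian g a with hΔdef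
  have hexp : Real.exp (Real.log a) = a := Real.exp_log ha0
  have hs : Ioc (0 : ℝ) 1 ∈ 𝓝 a := Ioc_mem_nhds ha.1 ha.2
  have hu := uniqueDiffOn_Ioc (0 : ℝ) 1
  have hslope : Tendsto (fun N => logSlope (gN N) (Real.log a)) atTop (𝓝 (a * deriv g a)) := by
    have h1 := (hQ.converges.tendsto_iteratedDeriv hQ.contDiffOn_lim hu hs (k := 1)
      (by norm_num)).comp (tendsto_id.prodMk (tendsto_const_nhds (x := a)))
    simp only [Function.comp_def, iteratedDeriv_one, id] at h1
    simp only [logSlope, hexp]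
    exact h1.const_mul a
  have hlow : Tendsto (fun N : ℕ => √N * logSlope (gN N) (Real.log a)) atTop atTop :=
    tendsto_sqrt_natCast_atTop.atTop_mul_pos (hQ.mul_deriv_pos ha) hslope
  have hup : Tendsto (fun N : ℕ => √N * (β - logSlope (gN N) (Real.log a))) atTop atTop :=
    tendsto_sqrt_natCast_atTop.atTop_mul_pos (sub_pos.2 (hQ.mul_deriv_lt ha)) (hslope.const_sub _)
  have hc : 0 < 4 * a ^ 2 * Δ := by positivity
  have key := tendsto_numberVariance hβ hQ hc (b₀ := Real.log a) (fun ε hε => by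
      have := hQ.converges.eventually_abs_logSlope_sub_le hQ.contDiffOn hQ.contDiffOn_lim hu
        (b := Real.log a) (by rwa [hexp]) hε
      rwa [hexp] at this)
    (tendsto_const_nhds (x := Real.log a)) MeasurableSet.univ hlow
    (Eventually.of_forall fun s => by
      filter_upwards [hup.eventually_ge_atTop s] with N hN using ⟨fun _ => mem_univ s, fun _ => hN⟩)
  rw [Measure.restrict_univ, integral_erfc_div (by positivity), hexp] at key
  have hval : 1 / √Δ * (√(2 * (4 * a ^ 2 * Δ)) / √(2 * Real.pi)) = 2 * a / √Real.pi := by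
    rw [show 2 * (4 * a ^ 2 * Δ) = 2 * ((2 * a) ^ 2 * Δ) by ring, Real.sqrt_mul (by norm_num),
      Real.sqrt_mul (by positivity), Real.sqrt_sq (by positivity), Real.sqrt_mul (by norm_num)]
    have h1 : √Δ ≠ 0 := by positivity
    have h2 : √(2 : ℝ) ≠ 0 := by positivity
    have h3 : √Real.pi ≠ 0 := by positivity
    field_simp
  rw [← hval]
  refine (key.const_mul (1 / √Δ)).congr fun N => ?_
  rw [Real.sqrt_mul (Nat.cast_nonneg N)]
  ring

theorem tendsto_numberVariance_edge (hβ : β = 2 ∨ β = 4) (hQ : IsSuitable β gN g)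
    (hE : IsEdgeRegular β gN g) (S : ℝ) :
    Tendsto (fun N : ℕ => (β : ℝ) / √((N : ℝ) * radialLaplacian g 1) *
      numberVariance β N (gN N) (1 - S / √(2 * radialLaplacian g 1 * (N : ℝ)))) atTop
      (𝓝 (2 / √Real.pi * edgeFunction S)) := by
  have hβ0 : (0 : ℝ) < β := by rcases hβ with rfl | rfl <;> norm_num
  have hΔ := hE.laplacian_pos
  set Δ := radialLaplacian g 1 with hΔdef
  obtain ⟨R, hR1, hgN, hg, hconv⟩ := hE.nhds
  have hexp : Real.exp 0 = 1 := Real.exp_zero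
  have hs : Ioo (0 : ℝ) R ∈ 𝓝 1 := Ioo_mem_nhds one_pos hR1
  have hc : 0 < 4 * Δ := by positivity
  have hlin : ∀ ε > 0, ∃ η > 0, ∀ᶠ N in atTop, ∀ x ∈ Metric.ball (0 : ℝ) η,
      ∀ y ∈ Metric.ball (0 : ℝ) η,
      |logSlope (gN N) y - logSlope (gN N) x - 4 * Δ * (y - x)| ≤ ε * |y - x| := by
    intro ε hε
    have := hconv.eventually_abs_logSlope_sub_le hgN hg (uniqueDiffOn_Ioo 0 R) (b := 0)
      (by rwa [hexp]) hε
    simpa only [hexp, one_pow, mul_one] using this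
  set y : ℝ := -(S / √(2 * Δ)) with hy
  set b : ℕ → ℝ := fun N => Real.log (1 + y / √N) with hb
  have hyb : Tendsto (fun N : ℕ => √N * b N) atTop (𝓝 y) :=
    (Real.tendsto_mul_log_one_add_div_atTop y).comp tendsto_sqrt_natCast_atTop
  have hy0 : Tendsto (fun N : ℕ => 1 + y / √(N : ℝ)) atTop (𝓝 1) := by
    simpa using (tendsto_sqrt_natCast_atTop.const_div_atTop y).const_add 1
  have hb0 : Tendsto b atTop (𝓝 0) := by
    rw [← Real.log_one]
    exact (Real.continuousAt_log one_ne_zero).tendsto.comp hy0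
  -- By the linearisation near the edge, this is asymptotic to `4 Δ √N b_N`.
  have hdiff : Tendsto (fun N : ℕ => √N * (logSlope (gN N) (b N) - logSlope (gN N) 0))
      atTop (𝓝 (4 * Δ * y)) := by
    have herr : Tendsto (fun N : ℕ => √N * (logSlope (gN N) (b N) - logSlope (gN N) 0) -
        4 * Δ * (√N * b N)) atTop (𝓝 0) := by
      rw [Metric.tendsto_nhds]
      intro ε hε
      obtain ⟨η, hη, hN⟩ := hlin (ε / (|y| + 1)) (by positivity)
      filter_upwards [hN, hb0.eventually (Metric.ball_mem_nhds 0 hη),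
        hyb.abs.eventually_lt_const (lt_add_one _)] with N h1 h2 h3
      have h4 := h1 0 (Metric.mem_ball_self hη) _ h2
      rw [sub_zero] at h4
      have e : √(N : ℝ) * (logSlope (gN N) (b N) - logSlope (gN N) 0) - 4 * Δ * (√N * b N) =
          √N * (logSlope (gN N) (b N) - logSlope (gN N) 0 - 4 * Δ * b N) := by ring
      rw [Real.dist_eq, sub_zero, e, abs_mul, abs_of_nonneg (Real.sqrt_nonneg _)]
      rw [abs_mul, abs_of_nonneg (Real.sqrt_nonneg _)] at h3
      calc _ ≤ √N * (ε / (|y| + 1) * |b N|) := by gcongr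
        _ = ε / (|y| + 1) * (√N * |b N|) := by ring
        _ < ε / (|y| + 1) * (|y| + 1) := by gcongr
        _ = ε := by field_simp
    have := herr.add (hyb.const_mul (4 * Δ))
    rw [zero_add] at this
    exact this.congr fun N => by ring
  have hzero : ∀ N, logSlope (gN N) 0 = deriv (gN N) 1 := fun N => by
    rw [logSlope, hexp, one_mul]
  have hU : √(2 * (4 * Δ)) * S = -(4 * Δ * y) := by
    have h8 : √(2 * (4 * Δ)) = 2 * √(2 * Δ) := by
      rw [show 2 * (4 * Δ) = 2 ^ 2 * (2 * Δ) by ring, Real.sqrt_mul (by norm_num),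
        Real.sqrt_sq (by norm_num)]
    have h9 : √(2 * Δ) * √(2 * Δ) = 2 * Δ := Real.mul_self_sqrt (by positivity)
    rw [h8, hy]
    field_simp
    linear_combination (2 * S) * h9
  have hup : Tendsto (fun N : ℕ => √N * (β - logSlope (gN N) (b N))) atTop
      (𝓝 (√(2 * (4 * Δ)) * S)) := by
    have := (hdiff.add hE.deriv_one).neg
    rw [add_zero, ← hU] at this
    refine this.congr fun N => ?_
    rw [hzero]
    ring
  have hslope : Tendsto (fun N => logSlope (gN N) (b N)) atTop (𝓝 (β : ℝ)) := by
    have h := (hup.mul tendsto_sqrt_natCast_atTop.inv_tendsto_atTop).const_sub (β : ℝ)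
    rw [mul_zero, sub_zero] at h
    refine h.congr' ?_
    filter_upwards [eventually_ge_atTop 1] with N hN
    have hN0 : (0 : ℝ) < N := by exact_mod_cast hN
    have : √(N : ℝ) ≠ 0 := by positivity
    simp only [Pi.inv_apply]
    field_simp
    ring
  have hlow : Tendsto (fun N : ℕ => √N * logSlope (gN N) (b N)) atTop atTop :=
    tendsto_sqrt_natCast_atTop.atTop_mul_pos hβ0 hslope
  have key := tendsto_numberVariance hβ hQ hc hlin hb0
    (measurableSet_Iic (a := √(2 * (4 * Δ)) * S)) hlow ?_
  · rw [setIntegral_Iic_erfc_div (by positivity)] at key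
    have hval : 1 / √Δ * (√(2 * (4 * Δ)) / √(2 * Real.pi) * edgeFunction S) =
        2 / √Real.pi * edgeFunction S := by
      rw [show 2 * (4 * Δ) = 2 * (2 ^ 2 * Δ) by ring, Real.sqrt_mul (by norm_num),
        Real.sqrt_mul (by positivity), Real.sqrt_sq (by positivity), Real.sqrt_mul (by norm_num)]
      have h1 : √Δ ≠ 0 := by positivity
      have h2 : √(2 : ℝ) ≠ 0 := by positivity
      have h3 : √Real.pi ≠ 0 := by positivity
      field_simp
    rw [← hval]
    refine (key.const_mul (1 / √Δ)).congr' ?_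
    filter_upwards [hy0.eventually_const_lt one_pos] with N hN
    have e : Real.exp (b N) = 1 - S / √(2 * Δ * N) := by
      rw [hb, Real.exp_log hN, hy, Real.sqrt_mul (show 0 ≤ 2 * Δ by positivity) (N : ℝ)]
      ring
    rw [e, Real.sqrt_mul (Nat.cast_nonneg N)]
    ring
  · filter_upwards [compl_mem_ae_iff.2 (measure_singleton (√(2 * (4 * Δ)) * S))] with s hs
    rcases lt_or_gt_of_ne (show s ≠ √(2 * (4 * Δ)) * S from hs) with h | h
    · filter_upwards [hup.eventually_const_lt h] with N hN
      exact ⟨fun _ => h.le, fun _ => hN.le⟩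
    · filter_upwards [hup.eventually_lt_const h] with N hN
      exact ⟨fun h' => absurd h' hN.not_ge, fun h' => absurd h' (not_le.2 h)⟩

end Potential

end CoulombGas

theorem theorem1p3 (β : ℕ) (hβ : β = 2 ∨ β = 4) (gN : ℕ → ℝ → ℝ) (g : ℝ → ℝ)
    (hQ : CoulombGas.IsSuitable β gN g) :
    (∀ a ∈ Ioo (0 : ℝ) 1,
      Tendsto
        (fun N : ℕ => (β : ℝ) / √((N : ℝ) * CoulombGas.radialLaplacian g a) *
          CoulombGas.numberVariance β N (gN N) a)
        atTop (𝓝 (2 * a / √Real.pi))) ∧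
    (CoulombGas.IsEdgeRegular β gN g → ∀ S : ℝ,
      Tendsto
        (fun N : ℕ => (β : ℝ) / √((N : ℝ) * CoulombGas.radialLaplacian g 1) *
          CoulombGas.numberVariance β N (gN N)
            (1 - S / √(2 * CoulombGas.radialLaplacian g 1 * (N : ℝ))))
        atTop (𝓝 (2 / √Real.pi * CoulombGas.edgeFunction S))) ∧
    (∀ S : ℝ, CoulombGas.edgeFunction S =
      CoulombGas.erfc (-(√2 * S)) / 2 - Real.exp (-S ^ 2) / √2 * CoulombGas.erf S +
        √(Real.pi / 2) * S * (CoulombGas.erfc S * CoulombGas.erfc (-S) / 2)) :=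
  ⟨fun _ ha => CoulombGas.tendsto_numberVariance_bulk hβ hQ ha,
    fun hE S => CoulombGas.tendsto_numberVariance_edge hβ hQ hE S,
    CoulombGas.edgeFunction_eq_edgeClosedForm⟩
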